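/- Let $k\ge 1$ and $0<m_1<\dots<m_k<1$. For a node $\alpha=(n_1,\dots,n_k)\in\mathbb N^k$ write $\alpha^l=(n_1,\dots,n_l)$, $0\le l\le k$. Points. For every $0\le l<k$ and every $p\in\mathbb N^{l}$ let $(u_{(p,n)})_{n\ge1}$ be a decreasing enumeration of a Poisson point process on $(0,\infty)$ with intensity measure $x^{-1-m_{l+1}}\,dx$, all these sequences being independent. Put $v_\alpha=\prod_{l=1}^k u_{\alpha^l}$ and $w_\alpha=v_\alpha/\sum_\beta v_\beta$. Marks. Let $\mathcal X_1,\dots,\mathcal X_k$ be complete separable metric spaces with their Borel $\sigma$-algebras and $\mathcal X^l=\mathcal X_1\times\dots\times\mathcal X_l$. Let $\nu_0$ be a probability measure on $\mathcal X_1$ and, for $1\le l<k$, let $\nu_l(\cdot\,|\,x)$, $x\in\mathcal X^l$, be a probability kernel from $\mathcal X^l$ to $\mathcal X_{l+1}$. Let $Z_\alpha=(z_{\alpha^1},\dots,z_{\alpha^k})\in\mathcal X^k$ be generated recursively and independently of the points $u$: for $0\le l<k$, conditionally on all marks $z_a$ with $a\in\mathbb N^j$, $1\le j\le l$, the marks $z_{(p,n)}$,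 $p\in\mathbb N^{l}$, $n\ge 1$, are independent, and $z_{(p,n)}$ has distribution $\nu_l(\cdot\,|\,Z_p)$, where $Z_p=(z_{p^1},\dots,z_{p^l})$. Reweighting. Let $X:\mathcal X^k\to\mathbb R$ be measurable with $\mathbb E\exp X(Z_\alpha)<\infty$. Put $X_k=X$ and, for $1\le l\le k$ and $x\in\mathcal X^{l-1}$, $$X_{l-1}(x)=\frac1{m_l}\log\int_{\mathcal X_l}\exp\bigl(m_lX_l(x,y)\bigr)\,\nu_{l-1}(dy\,|\,x),\qquad W_l(x,y)=\exp m_l\bigl(X_l(x,y)-X_{l-1}(x)\bigr).$$ (The integrals are finite for almost all values $x$ of $Z_{\alpha^{l-1}}$; values on the exceptional null set are irrelevant.) Then $X_0$ is a constant. Write $X_{\alpha^l}=X_l(Z_{\alpha^l})$ and $e_{\alpha^l}=\exp(X_{\alpha^l}-X_{\alpha^{l-1}})$. Let $Z'_\alpha$ be generated in the same way as $Z_\alpha$, independently of the points $u$, but with conditional distributions $W_l(x,y)\,\nu_{l-1}(dy\,|\,x)$ in place of $\nu_{l-1}(dy\,|\,x)$ for $1\le l\le k$. (No joint law of $Z$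 and $Z'$ is prescribed; $Z'$ may be defined, together with a copy of the points $u$, on another probability space.) Then: 1. The point processes $$\bigl\{(u_{\alpha^1}e_{\alpha^1},\dots,u_{\alpha^k}e_{\alpha^k},Z_\alpha)\bigr\}_{\alpha\in\mathbb N^k}\quad\text{and}\quad\bigl\{(u_{\alpha^1},\dots,u_{\alpha^k},Z'_\alpha)\bigr\}_{\alpha\in\mathbb N^k}$$ on $(\mathbb R^+)^k\times\mathcal X^k$, regarded as random counting measures (the sums of the Dirac masses at these points), have the same distribution. 2. The point processes $\{v_\alpha\exp(X_\alpha-X_0)\}_\alpha$ and $\{v_\alpha\}_\alpha$, regarded in the same way, have the same distribution. 3. Almost surely $0<\sum_\alpha v_\alpha<\infty$ and $\sum_\alpha w_\alpha\exp X_\alpha<\infty$; the random variable $\log\sum_\alpha w_\alpha\exp X_\alpha$ is integrable, and $$\mathbb E\log\sum_{\alpha\in\mathbb N^k}w_\alpha\exp X_\alpha=X_0 .$$ -/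

import Mathlib

open MeasureTheory ProbabilityTheory
open scoped ENNReal NNReal

namespace Cascade

section PointProcesses

variable {Ω E ι : Type*} [MeasurableSpace Ω] [MeasurableSpace E]

/-- The point process with points `x i`, as a random counting measure
`ω ↦ ∑ i, δ_{x i ω}`.  Its law is a measure on `Measure E`, which carries the σ-algebra generated
by the evaluations `N ↦ N B` at measurable sets `B`. -/
noncomputable def pointProcess (x : ι → Ω → E) (ω : Ω) : Measure E :=
  Measure.sum fun i => Measure.dirac (x i ω)

/-- A random measure `N` is a Poisson point process with intensity measure `μ`: `N B` is Poisson
with mean `μ B` (a.s. infinite when `μ B = ∞`), and the values of `N` on finitely many pairwise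
disjoint measurable sets are independent. -/
structure IsPoissonProcess (N : Ω → Measure E) (μ : Measure E) (P : Measure Ω) : Prop where
  aemeasurable : AEMeasurable N P
  law_of_lt_top : ∀ B, MeasurableSet B → μ B < ∞ →
    HasLaw (fun ω => N ω B)
      ((poissonMeasure (μ B).toNNReal).map fun n : ℕ => (n : ℝ≥0∞)) P
  eq_top : ∀ B, MeasurableSet B → μ B = ∞ → ∀ᵐ ω ∂P, N ω B = ∞
  indep : ∀ (n : ℕ) (B : Fin n → Set E), (∀ i, MeasurableSet (B i)) →
    Pairwise (Function.onFun Disjoint B) → iIndepFun (fun i ω => N ω (B i)) P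

/-- The measure `x ^ (-1 - m) dx` on `(0, ∞)`, extended by zero to the real line. -/
noncomputable def powerIntensity (m : ℝ) : Measure ℝ :=
  (volume.restrict (Set.Ioi 0)).withDensity fun x => ENNReal.ofReal (x ^ (-1 - m))

/-- `u` is a decreasing enumeration of a Poisson point process on `(0, ∞)` with intensity
measure `x ^ (-1 - m) dx`. -/
structure IsPoissonSequence (m : ℝ) (u : ℕ → Ω → ℝ) (P : Measure Ω) : Prop where
  antitone : ∀ᵐ ω ∂P, Antitone fun n => u n ω
  poisson : IsPoissonProcess (pointProcess u) (powerIntensity m) P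

/-- The point processes of a Derrida-Ruelle cascade with parameters `m`.  Levels are numbered from
`0`, so that `u l (n₀, …, n_l)` is the point attached to a node of generation `l + 1`.  The
sequence of children of each node (the root included) is a Poisson sequence, and these sequences
are independent. -/
structure IsPoissonCascade {k : ℕ} (m : Fin k → ℝ)
    (u : (l : Fin k) → (Fin (l + 1) → ℕ) → Ω → ℝ) (P : Measure Ω) : Prop where
  measurable : ∀ l a, Measurable (u l a)
  poisson : ∀ (l : Fin k) (p : Fin l → ℕ),
    IsPoissonSequence (m l) (fun n => u l (Fin.snoc (α := fun _ => ℕ) p n)) P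
  indep : iIndepFun
    (fun (p : Σ l : Fin k, (Fin l → ℕ)) ω (n : ℕ) =>
      u p.1 (Fin.snoc (α := fun _ => ℕ) p.2 n) ω) P

end PointProcesses

section Marks

variable (𝒳 : ℕ → Type*)

/-- The product `𝒳 0 × ⋯ × 𝒳 (l - 1)` of the first `l` spaces. -/
abbrev Prefix (l : ℕ) : Type _ := (i : Fin l) → 𝒳 i

variable {𝒳}

/-- The point `(x, y)` of the product of the first `l + 1` spaces. -/
def extend {l : ℕ} (x : Prefix 𝒳 l) (y : 𝒳 l) : Prefix 𝒳 (l + 1) :=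
  Fin.snoc (α := fun i : Fin (l + 1) => 𝒳 i) x y

variable {Ω : Type*} {k : ℕ}

/-- `Z_a = (z_{a₀}, z_{a₀ a₁}, …, z_{a₀ ⋯ a_{l-1}})`, the marks on the path from the root to the
node `a` of generation `l`. -/
def pathMarks (z : (l : Fin k) → (Fin (l + 1) → ℕ) → Ω → 𝒳 l) {l : ℕ} (hl : l ≤ k)
    (a : Fin l → ℕ) (ω : Ω) : Prefix 𝒳 l :=
  fun i => z (i.castLE hl) (Fin.take (i + 1) i.isLt a) ω

/-- All the marks of generations `1, …, l`. -/
def pastMarks (z : (l : Fin k) → (Fin (l + 1) → ℕ) → Ω → 𝒳 l) (l : Fin k) (ω : Ω) :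
    (j : Fin l) → (Fin (j + 1) → ℕ) → 𝒳 j :=
  fun j a => z (j.castLE l.isLt.le) a ω

variable [MeasurableSpace Ω] [∀ l, MeasurableSpace (𝒳 l)]

/-- The process `z` on the nodes of the tree is generated recursively with conditional
distributions `κ`: conditionally on all the marks of generations `1, …, l`, the marks of
generation `l + 1` are independent, and the mark of a child of the node `p` has distribution
`κ l (Z_p)`.  (The parent of `a` is `Fin.init a`; for `l = 0` the past is trivial and the marks of
the first generation are i.i.d.) -/
structure IsMarkProcess (κ : (l : Fin k) → Prefix 𝒳 l → Measure (𝒳 l))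
    (z : (l : Fin k) → (Fin (l + 1) → ℕ) → Ω → 𝒳 l) (P : Measure Ω) : Prop where
  measurable : ∀ l a, Measurable (z l a)
  cond_law : ∀ (l : Fin k) (C : Set ((j : Fin l) → (Fin (j + 1) → ℕ) → 𝒳 j)),
    MeasurableSet C → ∀ (S : Finset (Fin (l + 1) → ℕ)) (B : (Fin (l + 1) → ℕ) → Set (𝒳 l)),
    (∀ a, MeasurableSet (B a)) →
      P (pastMarks z l ⁻¹' C ∩ ⋂ a ∈ S, z l a ⁻¹' B a) =
        ∫⁻ ω in pastMarks z l ⁻¹' C,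
          ∏ a ∈ S, κ l (pathMarks z l.isLt.le (Fin.init (α := fun _ => ℕ) a) ω) (B a) ∂P

/-- The marks `z` are independent of the points `u` of the cascade. -/
def MarksIndep (u : (l : Fin k) → (Fin (l + 1) → ℕ) → Ω → ℝ)
    (z : (l : Fin k) → (Fin (l + 1) → ℕ) → Ω → 𝒳 l) (P : Measure Ω) : Prop :=
  IndepFun (fun ω l a => u l a ω) (fun ω l a => z l a ω) P

end Marks

section Recursion

variable {𝒳 : ℕ → Type*} [∀ l, MeasurableSpace (𝒳 l)] {k : ℕ}

/-- The functions `X_l` on the products of the first `l` spaces, `0 ≤ l ≤ k`: `X_k = X` and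
`X_l (x) = m⁻¹ log ∫ exp (m X_{l+1} (x, y)) ν_l (dy | x)`, where `m = m l` is the parameter of
generation `l + 1`. -/
noncomputable def levelFun (m : Fin k → ℝ) (ν : (l : Fin k) → Kernel (Prefix 𝒳 l) (𝒳 l))
    (X : Prefix 𝒳 k → ℝ) {l : ℕ} (hl : l ≤ k) : Prefix 𝒳 l → ℝ :=
  Nat.decreasingInduction (motive := fun j _ => Prefix 𝒳 j → ℝ)
    (fun j hj F x =>
      1 / m ⟨j, hj⟩ * Real.log (∫ y, Real.exp (m ⟨j, hj⟩ * F (extend x y)) ∂(ν ⟨j, hj⟩ x)))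
    X hl

theorem levelFun_self (m : Fin k → ℝ) (ν : (l : Fin k) → Kernel (Prefix 𝒳 l) (𝒳 l))
    (X : Prefix 𝒳 k → ℝ) : levelFun m ν X le_rfl = X :=
  Nat.decreasingInduction_self _ _

theorem levelFun_of_lt (m : Fin k → ℝ) (ν : (l : Fin k) → Kernel (Prefix 𝒳 l) (𝒳 l))
    (X : Prefix 𝒳 k → ℝ) (l : Fin k) (x : Prefix 𝒳 l) :
    levelFun m ν X l.isLt.le x =
      1 / m l * Real.log
        (∫ y, Real.exp (m l * levelFun m ν X (Nat.succ_le_of_lt l.isLt) (extend x y)) ∂(ν l x)) :=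
  congrFun (Nat.decreasingInduction_succ_left
    (motive := fun j _ => Prefix 𝒳 j → ℝ) _ _ (Nat.succ_le_of_lt l.isLt) l.isLt.le) x

/-- The constant `X_0`. -/
noncomputable def rootValue (m : Fin k → ℝ) (ν : (l : Fin k) → Kernel (Prefix 𝒳 l) (𝒳 l))
    (X : Prefix 𝒳 k → ℝ) : ℝ :=
  levelFun m ν X (Nat.zero_le k) fun i => i.elim0

/-- The density `W (x, y) = exp (m (X_{l+1} (x, y) - X_l (x)))`, with `m = m l`. -/
noncomputable def weight (m : Fin k → ℝ) (ν : (l : Fin k) → Kernel (Prefix 𝒳 l) (𝒳 l))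
    (X : Prefix 𝒳 k → ℝ) (l : Fin k) (x : Prefix 𝒳 l) (y : 𝒳 l) : ℝ :=
  Real.exp (m l * (levelFun m ν X (Nat.succ_le_of_lt l.isLt) (extend x y)
    - levelFun m ν X l.isLt.le x))

/-- The reweighted conditional distributions `W (x, y) ν_l (dy | x)`. -/
noncomputable def reweighted (m : Fin k → ℝ) (ν : (l : Fin k) → Kernel (Prefix 𝒳 l) (𝒳 l))
    (X : Prefix 𝒳 k → ℝ) (l : Fin k) (x : Prefix 𝒳 l) : Measure (𝒳 l) :=
  (ν l x).withDensity fun y => ENNReal.ofReal (weight m ν X l x y)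

variable {Ω : Type*}

/-- `u_{α^{l+1}}`, the point of the cascade at the ancestor of generation `l + 1` of the leaf
`α`. -/
def ancestorPoint (u : (l : Fin k) → (Fin (l + 1) → ℕ) → Ω → ℝ) (α : Fin k → ℕ) (l : Fin k)
    (ω : Ω) : ℝ :=
  u l (Fin.take (l + 1) (Nat.succ_le_of_lt l.isLt) α) ω

/-- `v_α`, the product of the points of the cascade along the path to the leaf `α`. -/
def leafWeight (u : (l : Fin k) → (Fin (l + 1) → ℕ) → Ω → ℝ) (α : Fin k → ℕ) (ω : Ω) : ℝ :=
  ∏ l : Fin k, ancestorPoint u α l ω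

/-- `w_α = v_α / ∑_β v_β`. -/
noncomputable def normalizedWeight (u : (l : Fin k) → (Fin (l + 1) → ℕ) → Ω → ℝ)
    (α : Fin k → ℕ) (ω : Ω) : ℝ :=
  leafWeight u α ω / ∑' β : Fin k → ℕ, leafWeight u β ω

/-- `e_{α^{l+1}} = exp (X_{α^{l+1}} - X_{α^l})`, where `X_{α^l} = X_l (Z_{α^l})`. -/
noncomputable def increment (m : Fin k → ℝ) (ν : (l : Fin k) → Kernel (Prefix 𝒳 l) (𝒳 l))
    (X : Prefix 𝒳 k → ℝ) (z : (l : Fin k) → (Fin (l + 1) → ℕ) → Ω → 𝒳 l) (α : Fin k → ℕ)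
    (l : Fin k) (ω : Ω) : ℝ :=
  Real.exp
    (levelFun m ν X (Nat.succ_le_of_lt l.isLt)
        (pathMarks z (Nat.succ_le_of_lt l.isLt)
          (Fin.take (l + 1) (Nat.succ_le_of_lt l.isLt) α) ω)
      - levelFun m ν X l.isLt.le (pathMarks z l.isLt.le (Fin.take l l.isLt.le α) ω))

end Recursion

end Cascade

namespace Cascade

open Filter Topology

/-! ### The function `x ↦ exp (-x)` on `[0, ∞]` -/

/-! The law of a point process is determined by its Laplace functional `E exp (-∑ f (points))`
(`ext_of_laplaceFunctional`), and for a cascade this functional can be computed from the leaves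
upward. Given everything else, the marks of the last generation are independent, and so are its
sequences of points. Averaging over these marks and then applying the Poisson Laplace functional
replaces `f` by `∫∫ (1 - exp (-f)) dκ x ^ (-1 - m) dx`, a function on paths shorter by one
(`laplace_succ`).

The substitution `x ↦ x e` multiplies integrals against `x ^ (-1 - m) dx` by `e ^ m`
(`lintegral_powerIntensity_mul`). The increments are chosen so that their power `m` is exactly the
density `W`. Multiplying the points of a generation by the increments therefore has the same effect
as reweighting its kernel (`levelStep_rescale`), and induction on generations gives the first
assertion (`laplace_rescale`).

For the second assertion only test functions of the product along a path matter. They see the kernel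
only through its total mass, and the reweighted kernels have mass one almost surely along the
original marks, by Jensen and `E exp X < ∞` (`ae_lintegral_weight_eq_one`). Hence no cascade with
reweighted marks has to be constructed.

For the third, put `V = ∑ v` and `V' = ∑ v exp (X - X₀)`. The logarithm in question is `log V' - log
V + X₀`, and `V'` and `V` have the same law, so it remains to prove that `log V` is integrable. The
same recursion gives `E exp (-t V) = exp (-C t ^ b)` (`lintegral_expNeg_totalMass`), where the
ordering of the parameters keeps the constants finite at every generation. This transform controls a
negative and a positive moment of `V` (`log_integrable_of_laplace`). -/

/-- The function `x ↦ exp (-x)` on `[0, ∞]`, with `exp (-∞) = 0`. -/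
noncomputable def expNeg (x : ℝ≥0∞) : ℝ≥0∞ := EReal.exp (-(x : EReal))

@[simp] lemma expNeg_zero : expNeg 0 = 1 := by simp [expNeg]

@[simp] lemma expNeg_top : expNeg ∞ = 0 := by simp [expNeg]

lemma continuous_expNeg : Continuous expNeg :=
  ENNReal.continuous_exp.comp (continuous_neg.comp continuous_coe_ennreal_ereal)

lemma measurable_expNeg : Measurable expNeg := continuous_expNeg.measurable

lemma expNeg_strictAnti : StrictAnti expNeg := fun _ _ h =>
  EReal.exp_strictMono (EReal.neg_lt_neg_iff.2 (EReal.coe_ennreal_lt_coe_ennreal_iff.2 h))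

lemma expNeg_antitone : Antitone expNeg := expNeg_strictAnti.antitone

lemma expNeg_injective : Function.Injective expNeg := expNeg_strictAnti.injective

lemma expNeg_le_one (x : ℝ≥0∞) : expNeg x ≤ 1 := by
  simpa using expNeg_antitone (zero_le (a := x))

lemma expNeg_ne_top (x : ℝ≥0∞) : expNeg x ≠ ∞ := ((expNeg_le_one x).trans_lt ENNReal.one_lt_top).ne

lemma expNeg_ofReal {x : ℝ} (hx : 0 ≤ x) :
    expNeg (ENNReal.ofReal x) = ENNReal.ofReal (Real.exp (-x)) := by
  rw [expNeg, EReal.coe_ennreal_ofReal, max_eq_left hx, ← EReal.coe_neg, EReal.exp_coe]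

lemma expNeg_add (x y : ℝ≥0∞) : expNeg (x + y) = expNeg x * expNeg y := by
  rw [expNeg, EReal.coe_ennreal_add, EReal.neg_add, sub_eq_add_neg, EReal.exp_add]
  · rfl
  · left; exact EReal.coe_ennreal_ne_bot _
  · right; exact EReal.coe_ennreal_ne_bot _

lemma expNeg_sum {ι : Type*} (s : Finset ι) (f : ι → ℝ≥0∞) :
    expNeg (∑ i ∈ s, f i) = ∏ i ∈ s, expNeg (f i) := by
  classical
  induction s using Finset.induction_on with
  | empty => simp
  | insert a s ha ih => rw [Finset.sum_insert ha, Finset.prod_insert ha, expNeg_add, ih]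

lemma tendsto_expNeg_sum {ι : Type*} (f : ι → ℝ≥0∞) :
    Tendsto (fun s : Finset ι => ∏ i ∈ s, expNeg (f i)) atTop (𝓝 (expNeg (∑' i, f i))) := by
  simp_rw [← expNeg_sum]
  exact (continuous_expNeg.tendsto _).comp ENNReal.summable.hasSum

/-- The inverse function `x ↦ -log x` of `expNeg`, extended by zero to `[1, ∞]`. -/
noncomputable def negLog (x : ℝ≥0∞) : ℝ≥0∞ := (-ENNReal.log x).toENNReal

lemma measurable_negLog : Measurable negLog :=
  ENNReal.measurable_log.neg.ereal_toENNReal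

lemma expNeg_negLog {x : ℝ≥0∞} (hx : x ≤ 1) : expNeg (negLog x) = x := by
  rw [expNeg, negLog, EReal.coe_toENNReal, neg_neg, ENNReal.exp_log]
  have : ENNReal.log x ≤ 0 := by simpa using ENNReal.log_monotone hx
  simpa using EReal.neg_le_neg_iff.2 this

lemma negLog_expNeg (x : ℝ≥0∞) : negLog (expNeg x) = x :=
  expNeg_injective (expNeg_negLog (expNeg_le_one x))

/-! ### Laplace transforms determine laws -/

/-- Finite measures on `[0, ∞]^J` are determined by their Laplace transforms. -/
lemma ext_of_lintegral_expNeg {J : Type*} [Fintype J] {μ ν : Measure (J → ℝ≥0∞)}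
    [IsFiniteMeasure μ] [IsFiniteMeasure ν]
    (h : ∀ t : J → ℕ, ∫⁻ x, expNeg (∑ j, t j * x j) ∂μ = ∫⁻ x, expNeg (∑ j, t j * x j) ∂ν) :
    μ = ν := by
  classical
  have hcont : ∀ t : J → ℕ, Continuous fun x : J → ℝ≥0∞ => expNeg (∑ j, t j * x j) := fun t =>
    continuous_expNeg.comp (continuous_finsetSum _ fun j _ =>
      (ENNReal.continuous_const_mul (by simp)).comp (continuous_apply j))
  have hcont' : ∀ t : J → ℕ,
      Continuous fun x : J → ℝ≥0∞ => (expNeg (∑ j, t j * x j)).toReal := fun t =>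
    ENNReal.continuousOn_toReal.comp_continuous (hcont t) fun x => expNeg_ne_top _
  -- Products of exponentials are exponentials, so the algebra generated by this submonoid is its
  -- linear span; agreement of the integrals on exponentials then extends by linearity. The algebra
  -- separates points, hence determines finite measures.
  let S : Submonoid (BoundedContinuousFunction (J → ℝ≥0∞) ℝ) :=
    { carrier := {g | ∃ t : J → ℕ, ∀ x, g x = (expNeg (∑ j, t j * x j)).toReal}
      one_mem' := ⟨0, fun x => by simp⟩
      mul_mem' := by
        rintro f g ⟨s, hs⟩ ⟨t, ht⟩
        refine ⟨s + t, fun x => ?_⟩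
        rw [BoundedContinuousFunction.mul_apply, hs, ht, ← ENNReal.toReal_mul, ← expNeg_add,
          ← Finset.sum_add_distrib]
        simp [add_mul] }
  let A : StarSubalgebra ℝ (BoundedContinuousFunction (J → ℝ≥0∞) ℝ) :=
    { Algebra.adjoin ℝ (S : Set _) with
      star_mem' := fun {a} ha => by
        have : star a = a := by ext x; simp
        rw [this]; exact ha }
  have hAS : ∀ g ∈ S, g ∈ A := fun g hg => Algebra.subset_adjoin hg
  refine ext_of_forall_mem_subalgebra_integral_eq_of_polish (𝕜 := ℝ) (A := A) ?_ ?_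
  · intro x y hxy
    obtain ⟨j, hj⟩ := Function.ne_iff.1 hxy
    let t : J → ℕ := Pi.single j 1
    let g : BoundedContinuousFunction (J → ℝ≥0∞) ℝ :=
      BoundedContinuousFunction.mkOfCompact ⟨_, hcont' t⟩
    have hg : ∀ x, g x = (expNeg (x j)).toReal := fun x => by
      change (expNeg (∑ i, t i * x i)).toReal = _
      congr 2
      rw [Finset.sum_eq_single j]
      · simp [t]
      · intro i _ hi; simp [t, hi]
      · simp
    refine ⟨g, ⟨_, ⟨g, hAS g ⟨t, fun x => rfl⟩, rfl⟩, rfl⟩, fun hgxy => hj ?_⟩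
    change g x = g y at hgxy
    rw [hg, hg, ENNReal.toReal_eq_toReal_iff' (expNeg_ne_top _) (expNeg_ne_top _)] at hgxy
    exact expNeg_injective hgxy
  · intro g hg
    have hg' : g ∈ Subalgebra.toSubmodule (Algebra.adjoin ℝ (S : Set _)) := hg
    rw [Algebra.adjoin_eq_span, Submonoid.closure_eq] at hg'
    clear hg
    induction hg' using Submodule.span_induction with
    | mem g hg =>
      obtain ⟨t, ht⟩ := hg
      simp_rw [ht]
      rw [integral_toReal (hcont t).measurable.aemeasurable
          (Eventually.of_forall fun x => (expNeg_ne_top _).lt_top),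
        integral_toReal (hcont t).measurable.aemeasurable
          (Eventually.of_forall fun x => (expNeg_ne_top _).lt_top), h]
    | zero => simp
    | add f g hf hg ihf ihg =>
      simp only [BoundedContinuousFunction.coe_add, Pi.add_apply]
      rw [integral_add (f.integrable μ) (g.integrable μ), integral_add (f.integrable ν)
        (g.integrable ν), ihf, ihg]
    | smul c f hf ih =>
      simp only [BoundedContinuousFunction.coe_smul, integral_smul, ih]

/-- Laws of random measures are determined by their Laplace functionals. -/
lemma ext_of_laplaceFunctional {E : Type*} [MeasurableSpace E] {M M' : Measure (Measure E)}
    [IsFiniteMeasure M] [IsFiniteMeasure M']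
    (h : ∀ f : E → ℝ≥0∞, Measurable f →
      ∫⁻ N, expNeg (∫⁻ x, f x ∂N) ∂M = ∫⁻ N, expNeg (∫⁻ x, f x ∂N) ∂M') : M = M' := by
  -- The σ-algebra on measures is pulled back from the product by this evaluation map, and laws on
  -- the product are determined by their finite-dimensional marginals. Test functions that are
  -- combinations of indicators give the Laplace transforms of these marginals.
  let Φ : Measure E → ({B : Set E // MeasurableSet B} → ℝ≥0∞) := fun N B => N B
  have hΦ : Measurable Φ := measurable_pi_lambda _ fun B => Measure.measurable_coe B.2
  have key : M.map Φ = M'.map Φ := by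
    have hp : IsProjectiveLimit (M.map Φ) (fun I => (M.map Φ).map I.restrict) := fun I => rfl
    refine hp.unique fun I => ?_
    beta_reduce
    have hI : Measurable (I.restrict (π := fun _ : {B : Set E // MeasurableSet B} => ℝ≥0∞)) :=
      Finset.measurable_restrict I
    refine ext_of_lintegral_expNeg fun t => ?_
    have hm : Measurable fun x : I → ℝ≥0∞ => expNeg (∑ j, t j * x j) :=
      measurable_expNeg.comp (Finset.measurable_sum _ fun j _ =>
        (measurable_pi_apply j).const_mul _)
    rw [Measure.map_map hI hΦ, Measure.map_map hI hΦ, lintegral_map hm (hI.comp hΦ),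
      lintegral_map hm (hI.comp hΦ)]
    have hf : Measurable fun x : E => ∑ j : I, (t j : ℝ≥0∞) * (j.1.1).indicator 1 x :=
      Finset.measurable_sum _ fun j _ => (measurable_one.indicator j.1.2).const_mul _
    have hN : ∀ N : Measure E, ∫⁻ x, ∑ j : I, (t j : ℝ≥0∞) * (j.1.1).indicator 1 x ∂N =
        ∑ j, t j * (I.restrict ∘ Φ) N j := fun N => by
      rw [lintegral_finsetSum _ fun j _ => (measurable_one.indicator j.1.2).const_mul _]
      refine Finset.sum_congr rfl fun j _ => ?_
      rw [lintegral_const_mul _ (measurable_one.indicator j.1.2), lintegral_indicator_one j.1.2]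
      rfl
    have := h _ hf
    simp_rw [hN] at this
    exact this.symm
  ext s hs
  have hc : (Measure.instMeasurableSpace : MeasurableSpace (Measure E)) ≤
      MeasurableSpace.comap Φ inferInstance := by
    refine iSup_le fun B => iSup_le fun hB => ?_
    rw [← measurable_iff_comap_le]
    exact (measurable_pi_apply (⟨B, hB⟩ : {B : Set E // MeasurableSet B})).comp
      (comap_measurable Φ)
  obtain ⟨t, ht, rfl⟩ := hc s hs
  rw [← Measure.map_apply hΦ ht, ← Measure.map_apply hΦ ht, key]

/-! ### Laplace functionals of point processes -/

section PointProcess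

variable {Ω Ω' E ι : Type*} [MeasurableSpace Ω] [MeasurableSpace Ω'] [MeasurableSpace E]

omit [MeasurableSpace Ω] in
lemma lintegral_pointProcess (x : ι → Ω → E) (ω : Ω) {f : E → ℝ≥0∞} (hf : Measurable f) :
    ∫⁻ y, f y ∂(pointProcess x ω) = ∑' i, f (x i ω) := by
  simp [pointProcess, lintegral_sum_measure, lintegral_dirac' _ hf]

lemma measurable_pointProcess [Countable ι] {x : ι → Ω → E} (hx : ∀ i, Measurable (x i)) :
    Measurable (pointProcess x) := by
  refine Measure.measurable_of_measurable_coe _ fun B hB => ?_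
  have : (fun ω => pointProcess x ω B) = fun ω => ∑' i, B.indicator 1 (x i ω) := by
    ext ω
    rw [← lintegral_indicator_one hB, lintegral_pointProcess _ _ (measurable_one.indicator hB)]
  rw [this]
  exact Measurable.tsum fun i => (measurable_one.indicator hB).comp (hx i)

/-- Two point processes with the same Laplace functional have the same law. -/
lemma identDistrib_pointProcess [Countable ι] {P : Measure Ω} {P' : Measure Ω'}
    [IsFiniteMeasure P] [IsFiniteMeasure P'] {x : ι → Ω → E} {x' : ι → Ω' → E}
    (hx : ∀ i, Measurable (x i)) (hx' : ∀ i, Measurable (x' i))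
    (h : ∀ f : E → ℝ≥0∞, Measurable f → ∫⁻ ω, expNeg (∑' i, f (x i ω)) ∂P =
      ∫⁻ ω, expNeg (∑' i, f (x' i ω)) ∂P') :
    IdentDistrib (pointProcess x) (pointProcess x') P P' := by
  refine ⟨(measurable_pointProcess hx).aemeasurable, (measurable_pointProcess hx').aemeasurable,
    ext_of_laplaceFunctional fun f hf => ?_⟩
  have hm : Measurable fun N : Measure E => expNeg (∫⁻ x, f x ∂N) :=
    measurable_expNeg.comp (Measure.measurable_lintegral hf)
  rw [lintegral_map hm (measurable_pointProcess hx), lintegral_map hm (measurable_pointProcess hx')]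
  simp_rw [lintegral_pointProcess _ _ hf]
  exact h f hf

end PointProcess

/-! ### The Laplace functional of a Poisson process -/

lemma expNeg_mul_natCast (c : ℝ≥0∞) (n : ℕ) : expNeg (c * n) = expNeg c ^ n := by
  induction n with
  | zero => simp
  | succ n ih => rw [Nat.cast_succ, mul_add, expNeg_add, ih, mul_one, pow_succ]

/-- The generating function of the Poisson law at `q = exp (-c)`, summed as an exponential series;
`c = ∞` is the value `q = 0`. -/
lemma lintegral_expNeg_mul_poissonMeasure (r : ℝ≥0) (c : ℝ≥0∞) :
    ∫⁻ n : ℕ, expNeg (c * n) ∂(poissonMeasure r) = expNeg (r * (1 - expNeg c)) := by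
  obtain ⟨q, hq⟩ : ∃ q : ℝ≥0, expNeg c = q := ⟨_, (ENNReal.coe_toNNReal (expNeg_ne_top c)).symm⟩
  have hq1 : q ≤ 1 := by exact_mod_cast hq ▸ expNeg_le_one c
  have hq1' : (q : ℝ) ≤ 1 := by exact_mod_cast hq1
  have hr : (r : ℝ≥0∞) * (1 - q) = ENNReal.ofReal (r * (1 - q)) := by
    rw [ENNReal.ofReal_mul (by positivity), ENNReal.ofReal_coe_nnreal,
      ENNReal.ofReal_sub _ (by positivity), ENNReal.ofReal_one, ENNReal.ofReal_coe_nnreal]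
  simp_rw [expNeg_mul_natCast, hq]
  have hrq : 0 ≤ (r : ℝ) * (1 - q) := mul_nonneg r.2 (sub_nonneg.2 hq1')
  rw [hr, expNeg_ofReal hrq, lintegral_countable']
  have hterm : ∀ n : ℕ, (q : ℝ≥0∞) ^ n * poissonMeasure r {n} =
      ENNReal.ofReal (Real.exp (-r) * ((r * q : ℝ) ^ n / n.factorial)) := fun n => by
    rw [poissonMeasure_singleton, ← ENNReal.ofReal_coe_nnreal, ← ENNReal.ofReal_pow (by positivity),
      ← ENNReal.ofReal_mul (by positivity)]
    congr 1
    rw [mul_pow]; ring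
  have hs : HasSum (fun n : ℕ => Real.exp (-r) * ((r * q : ℝ) ^ n / n.factorial))
      (Real.exp (-r) * Real.exp (r * q)) := by
    have := (NormedSpace.expSeries_div_hasSum_exp (r * q : ℝ)).mul_left (Real.exp (-r))
    rwa [← Real.exp_eq_exp_ℝ] at this
  simp_rw [hterm]
  rw [← ENNReal.ofReal_tsum_of_nonneg (fun n => by positivity) hs.summable, hs.tsum_eq,
    ← Real.exp_add]
  congr 2; ring

section Poisson

variable {Ω E : Type*} [MeasurableSpace Ω] [MeasurableSpace E] {N : Ω → Measure E} {μ : Measure E}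
  {P : Measure Ω} [IsProbabilityMeasure P]

/-- For finite `μ B` this is the Poisson transform. For `μ B = ∞` the count is almost surely
infinite, and both sides are `0`, or `1` when `c = 0`. -/
lemma IsPoissonProcess.lintegral_expNeg_mul (h : IsPoissonProcess N μ P) {B : Set E}
    (hB : MeasurableSet B) (c : ℝ≥0∞) :
    ∫⁻ ω, expNeg (c * N ω B) ∂P = expNeg ((1 - expNeg c) * μ B) := by
  have hm : Measurable fun x : ℝ≥0∞ => expNeg (c * x) :=
    measurable_expNeg.comp (measurable_id.const_mul c)
  rcases eq_or_ne (μ B) ∞ with hB' | hB'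
  · have h1 : ∫⁻ ω, expNeg (c * N ω B) ∂P = ∫⁻ _, expNeg (c * ∞) ∂P := by
      refine lintegral_congr_ae ?_
      filter_upwards [h.eq_top B hB hB'] with ω hω
      rw [hω]
    rw [h1, lintegral_const, measure_univ, mul_one, hB']
    rcases eq_or_ne c 0 with rfl | hc
    · simp
    · have : expNeg c < 1 := by
        rw [← expNeg_zero]; exact expNeg_strictAnti (pos_iff_ne_zero.2 hc)
      rw [ENNReal.mul_top hc, ENNReal.mul_top (tsub_pos_of_lt this).ne']
  · have hl := h.law_of_lt_top B hB hB'.lt_top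
    have : ∫⁻ ω, expNeg (c * N ω B) ∂P = ∫⁻ x, expNeg (c * x) ∂(P.map fun ω => N ω B) :=
      (lintegral_map' hm.aemeasurable hl.aemeasurable).symm
    rw [this, hl.map_eq, lintegral_map hm (measurable_of_countable _),
      lintegral_expNeg_mul_poissonMeasure, ENNReal.coe_toNNReal hB', mul_comm]

/-- The level sets of `g` are disjoint, so their counts are independent and the transform factorizes
over the values of `g`. -/
lemma IsPoissonProcess.lintegral_expNeg_simpleFunc (h : IsPoissonProcess N μ P)
    (hN : Measurable N) (g : SimpleFunc E ℝ≥0∞) :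
    ∫⁻ ω, expNeg (∫⁻ x, g x ∂(N ω)) ∂P = expNeg (∫⁻ x, (1 - expNeg (g x)) ∂μ) := by
  have hμ : ∫⁻ x, (1 - expNeg (g x)) ∂μ =
      ∑ c ∈ g.range, (1 - expNeg c) * μ (g ⁻¹' {c}) := by
    rw [← SimpleFunc.map_lintegral (fun c => 1 - expNeg c), ← SimpleFunc.lintegral_eq_lintegral]
    rfl
  have hN' : ∀ ω, ∫⁻ x, g x ∂(N ω) = ∑ c ∈ g.range, c * N ω (g ⁻¹' {c}) := fun ω => by
    rw [SimpleFunc.lintegral_eq_lintegral]; rfl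
  simp_rw [hN', hμ, expNeg_sum]
  have e := g.range.equivFin.symm
  have hconv : ∀ F : ℝ≥0∞ → ℝ≥0∞, ∏ c ∈ g.range, F c = ∏ i, F (e i) := fun F => by
    rw [← Finset.prod_coe_sort, ← e.prod_comp]
  simp_rw [hconv]
  have hB : ∀ i, MeasurableSet (g ⁻¹' {((e i : g.range) : ℝ≥0∞)}) := fun i =>
    g.measurableSet_preimage _
  have hind := h.indep _ (fun i => g ⁻¹' {((e i : g.range) : ℝ≥0∞)}) hB fun i j hij => by
    refine Disjoint.preimage _ (Set.disjoint_singleton.2 fun hc => hij ?_)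
    exact e.injective (Subtype.ext hc)
  have hm : ∀ c : ℝ≥0∞, Measurable fun x : ℝ≥0∞ => expNeg (c * x) := fun c =>
    measurable_expNeg.comp (measurable_id.const_mul c)
  have hind' := hind.comp (fun i x => expNeg ((e i : g.range) * x)) fun i => hm _
  have := lintegral_prod_eq_prod_lintegral_of_indepFun Finset.univ _ hind' fun i =>
    (hm _).comp ((Measure.measurable_coe (hB i)).comp hN)
  simp only [Function.comp_apply] at this
  rw [this]
  exact Finset.prod_congr rfl fun i _ => h.lintegral_expNeg_mul (hB i) _

/-- The Laplace functional of a Poisson process. -/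
lemma IsPoissonProcess.laplaceFunctional (h : IsPoissonProcess N μ P) (hN : Measurable N)
    {f : E → ℝ≥0∞} (hf : Measurable f) :
    ∫⁻ ω, expNeg (∫⁻ x, f x ∂(N ω)) ∂P = expNeg (∫⁻ x, (1 - expNeg (f x)) ∂μ) := by
  -- Along increasing simple functions the left side converges by domination by `1`; on the right `1
  -- - exp (-f)` increases, so no finiteness of `μ` is needed.
  have hm : ∀ x, Monotone fun n => SimpleFunc.eapprox f n x := fun x _ _ hij =>
    SimpleFunc.monotone_eapprox f hij x
  have h1 : Tendsto (fun n => ∫⁻ ω, expNeg (∫⁻ x, SimpleFunc.eapprox f n x ∂(N ω)) ∂P) atTop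
      (𝓝 (∫⁻ ω, expNeg (∫⁻ x, f x ∂(N ω)) ∂P)) := by
    refine tendsto_lintegral_of_dominated_convergence (fun _ => 1) (fun n => ?_) (fun n => ?_)
      (by simp) (Eventually.of_forall fun ω => ?_)
    · exact measurable_expNeg.comp
        ((Measure.measurable_lintegral (SimpleFunc.measurable _)).comp hN)
    · exact Eventually.of_forall fun ω => expNeg_le_one _
    · exact (continuous_expNeg.tendsto _).comp (lintegral_tendsto_of_tendsto_of_monotone
        (fun n => (SimpleFunc.measurable _).aemeasurable) (Eventually.of_forall fun x => hm x)
        (Eventually.of_forall fun x => SimpleFunc.tendsto_eapprox hf x))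
  have h2 : Tendsto (fun n => expNeg (∫⁻ x, (1 - expNeg (SimpleFunc.eapprox f n x)) ∂μ)) atTop
      (𝓝 (expNeg (∫⁻ x, (1 - expNeg (f x)) ∂μ))) := by
    refine (continuous_expNeg.tendsto _).comp (lintegral_tendsto_of_tendsto_of_monotone
      (fun n => ?_) (Eventually.of_forall fun x => ?_) (Eventually.of_forall fun x => ?_))
    · exact (measurable_const.sub (measurable_expNeg.comp (SimpleFunc.measurable _))).aemeasurable
    · exact fun i j hij => tsub_le_tsub_left (expNeg_antitone (hm x hij)) _
    · exact ENNReal.Tendsto.sub tendsto_const_nhds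
        ((continuous_expNeg.tendsto _).comp (SimpleFunc.tendsto_eapprox hf x)) (by simp)
  simp_rw [h.lintegral_expNeg_simpleFunc hN] at h1
  exact tendsto_nhds_unique h1 h2

/-- The Laplace functional of a Poisson sequence. -/
lemma IsPoissonSequence.lintegral_expNeg {m : ℝ} {u : ℕ → Ω → ℝ} (h : IsPoissonSequence m u P)
    (hu : ∀ n, Measurable (u n)) {f : ℝ → ℝ≥0∞} (hf : Measurable f) :
    ∫⁻ ω, expNeg (∑' n, f (u n ω)) ∂P = expNeg (∫⁻ x, (1 - expNeg (f x)) ∂(powerIntensity m)) := by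
  rw [← h.poisson.laplaceFunctional (measurable_pointProcess hu) hf]
  simp_rw [lintegral_pointProcess _ _ hf]

/-- The points of a Poisson sequence are positive. -/
lemma IsPoissonSequence.ae_pos {m : ℝ} {u : ℕ → Ω → ℝ} (h : IsPoissonSequence m u P)
    (hu : ∀ n, Measurable (u n)) : ∀ᵐ ω ∂P, ∀ n, 0 < u n ω := by
  -- With the test function equal to `∞` on `(-∞, 0]`, the functional is the probability of having
  -- no point there; the intensity does not charge this set.
  have hf : Measurable ((Set.Iic (0 : ℝ)).indicator fun _ => (∞ : ℝ≥0∞)) :=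
    measurable_const.indicator measurableSet_Iic
  have h0 : ∫⁻ x, (1 - expNeg ((Set.Iic (0 : ℝ)).indicator (fun _ => (∞ : ℝ≥0∞)) x))
      ∂(powerIntensity m) = 0 := by
    have : ∀ᵐ x ∂(powerIntensity m), x ∈ Set.Ioi (0 : ℝ) :=
      (withDensity_absolutelyContinuous _ _).ae_le (ae_restrict_mem measurableSet_Ioi)
    refine (lintegral_eq_zero_iff (measurable_const.sub (measurable_expNeg.comp hf))).2 ?_
    filter_upwards [this] with x hx
    have hx' : x ∉ Set.Iic (0 : ℝ) := by simpa using hx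
    simp only [Pi.sub_apply, Function.comp_apply, Set.indicator_of_notMem hx', expNeg_zero,
      tsub_self, Pi.zero_apply]
  have h1 := h.lintegral_expNeg hu hf
  rw [h0, expNeg_zero] at h1
  have h2 : (fun _ => 1) =ᵐ[P] fun ω =>
      expNeg (∑' n, (Set.Iic (0 : ℝ)).indicator (fun _ => (∞ : ℝ≥0∞)) (u n ω)) :=
    (ae_eq_of_ae_le_of_lintegral_le (Eventually.of_forall fun ω => expNeg_le_one _)
      (by simp [h1]) measurable_const.aemeasurable (by simp [h1])).symm
  filter_upwards [h2] with ω hω n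
  rw [← expNeg_zero] at hω
  have := (ENNReal.tsum_eq_zero.1 (expNeg_injective hω).symm) n
  by_contra hn
  rw [Set.indicator_of_mem (show u n ω ∈ Set.Iic (0 : ℝ) from not_lt.1 hn)] at this
  exact ENNReal.top_ne_zero this

end Poisson

/-! ### Conditionally independent families -/

section CondIndep

variable {Ω A ι : Type*} [MeasurableSpace Ω] [MeasurableSpace A] {B : ι → Type*}
  [∀ i, MeasurableSpace (B i)]

/-- The variables `y i` are conditionally independent given `past`, with conditional distributions
`κ i past`. -/
structure CondIndepFamily (past : Ω → A) (y : ∀ i, Ω → B i) (κ : ∀ i, Kernel A (B i))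
    (P : Measure Ω) : Prop where
  measurable_past : Measurable past
  measurable : ∀ i, Measurable (y i)
  cond_law : ∀ C, MeasurableSet C → ∀ (S : Finset ι) (D : ∀ i, Set (B i)),
    (∀ i, MeasurableSet (D i)) → P (past ⁻¹' C ∩ ⋂ i ∈ S, y i ⁻¹' D i) =
      ∫⁻ ω in past ⁻¹' C, ∏ i ∈ S, κ i (past ω) (D i) ∂P

variable {past : Ω → A} {y : ∀ i, Ω → B i} {κ : ∀ i, Kernel A (B i)} {P : Measure Ω}

/-- Taking the full space as target in `cond_law` shows that the total mass integrates to the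
measure of every past event. This replaces a Markov assumption, which the reweighted kernels need
not satisfy everywhere. -/
lemma CondIndepFamily.ae_eq_one [IsFiniteMeasure P] (h : CondIndepFamily past y κ P) (i : ι) :
    ∀ᵐ ω ∂P, κ i (past ω) Set.univ = 1 := by
  have hm : Measurable fun a => κ i a Set.univ := (κ i).measurable_coe MeasurableSet.univ
  have : (fun a => κ i a Set.univ) =ᵐ[P.map past] fun _ => 1 := by
    refine ae_eq_of_forall_setLIntegral_eq_of_sigmaFinite hm measurable_const fun C hC _ => ?_
    have := h.cond_law C hC {i} (fun _ => Set.univ) fun _ => MeasurableSet.univ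
    rw [setLIntegral_map hC hm h.measurable_past]
    simpa [Measure.map_apply h.measurable_past hC] using this.symm
  exact ae_of_ae_map h.measurable_past.aemeasurable this

variable [∀ i, IsSFiniteKernel (κ i)]

/-- Indicators are exchanged for general functions of the past and one variable, one index at a
time: `T` holds the indices already exchanged, `S` those still carrying indicators. Quantifying over
`S`, `D` and `C` inside the induction lets the next index enter as an indicator. -/
lemma CondIndepFamily.setLIntegral_prod [IsFiniteMeasure P] (h : CondIndepFamily past y κ P)
    {g : ∀ i, A × B i → ℝ≥0∞} (hg : ∀ i, Measurable (g i)) (hg1 : ∀ i x, g i x ≤ 1)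
    (T : Finset ι) : ∀ S : Finset ι, Disjoint T S → ∀ D : ∀ i, Set (B i),
    (∀ i, MeasurableSet (D i)) → ∀ C, MeasurableSet C →
      ∫⁻ ω in past ⁻¹' C, (∏ i ∈ T, g i (past ω, y i ω)) *
          ∏ i ∈ S, (D i).indicator 1 (y i ω) ∂P =
        ∫⁻ ω in past ⁻¹' C, (∏ i ∈ T, ∫⁻ b, g i (past ω, b) ∂(κ i (past ω))) *
          ∏ i ∈ S, κ i (past ω) (D i) ∂P := by
  classical
  have hp := h.measurable_past
  have hy := h.measurable
  have hI : ∀ (S : Finset ι) (D : ∀ i, Set (B i)) ω,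
      ∏ i ∈ S, (D i).indicator (1 : B i → ℝ≥0∞) (y i ω) =
        (⋂ i ∈ S, y i ⁻¹' D i).indicator 1 ω := fun S D ω => by
    by_cases hω : ω ∈ ⋂ i ∈ S, y i ⁻¹' D i
    · rw [Set.indicator_of_mem hω]
      refine Finset.prod_eq_one fun i hi => ?_
      rw [Set.indicator_of_mem (show y i ω ∈ D i from Set.mem_iInter₂.1 hω i hi)]; rfl
    · rw [Set.indicator_of_notMem hω]
      rw [Set.mem_iInter₂] at hω
      push Not at hω
      obtain ⟨i, hi, hiω⟩ := hω
      exact Finset.prod_eq_zero hi (Set.indicator_of_notMem (show y i ω ∉ D i from hiω) _)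
  have hgy : ∀ i, Measurable fun ω => g i (past ω, y i ω) := fun i =>
    (hg i).comp (hp.prodMk (hy i))
  have hgκ : ∀ i, Measurable fun a => ∫⁻ b, g i (a, b) ∂(κ i a) := fun i =>
    (hg i).lintegral_kernel_prod_right'
  induction T using Finset.induction_on with
  | empty =>
    intro S _ D hD C hC
    have hmeas : MeasurableSet (⋂ i ∈ S, y i ⁻¹' D i) :=
      S.measurableSet_biInter fun i _ => hy i (hD i)
    simp only [Finset.prod_empty, one_mul]
    simp_rw [hI]
    rw [lintegral_indicator_one hmeas, Measure.restrict_apply hmeas, Set.inter_comm,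
      h.cond_law C hC S D hD]
  | insert a T ha ih =>
    intro S hTS D hD C hC
    have haS : a ∉ S := Finset.disjoint_left.1 hTS (Finset.mem_insert_self a T)
    have hTS' : Disjoint T S := Finset.disjoint_of_subset_left (Finset.subset_insert a T) hTS
    set R : Ω → ℝ≥0∞ := fun ω => (∏ i ∈ T, g i (past ω, y i ω)) *
      ∏ i ∈ S, (D i).indicator 1 (y i ω) with hR
    set R' : A → ℝ≥0∞ := fun x => (∏ i ∈ T, ∫⁻ b, g i (x, b) ∂(κ i x)) *
      ∏ i ∈ S, κ i x (D i) with hR'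
    have hRm : Measurable R :=
      (Finset.measurable_prod _ fun i _ => hgy i).mul
        (Finset.measurable_prod _ fun i _ => (measurable_one.indicator (hD i)).comp (hy i))
    have hRm' : Measurable R' :=
      (Finset.measurable_prod _ fun i _ => hgκ i).mul
        (Finset.measurable_prod _ fun i _ => (κ i).measurable_coe (hD i))
    have hR1 : ∀ ω, R ω ≤ 1 := fun ω =>
      mul_le_one' (Finset.prod_le_one' fun i _ => hg1 i _) (Finset.prod_le_one' fun i _ =>
        Set.indicator_le_self' (fun _ _ => zero_le) _)
    have hpa : Measurable fun ω => (past ω, y a ω) := hp.prodMk (hy a)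
    have hfin : IsFiniteMeasure (P.withDensity R) := by
      refine isFiniteMeasure_withDensity ((lintegral_mono hR1).trans_lt ?_).ne
      simp
    -- Under the density formed by the other factors, the pair of the past and `y a` disintegrates
    -- along `κ a`. On rectangles this is the induction hypothesis with `a` added to the indicator
    -- indices.
    have hρ : (P.withDensity R).map (fun ω => (past ω, y a ω)) =
        ((P.map past).withDensity R') ⊗ₘ κ a := by
      refine Measure.ext_prod fun {C' D'} hC' hD' => ?_
      have := ih (insert a S) (by simp [hTS', ha]) (Function.update D a D')
        (fun i => by
          rcases eq_or_ne i a with rfl | hi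
          · simpa using hD'
          · simpa [hi] using hD i) C' hC'
      have e1 : ∀ ω, ∏ i ∈ S, (Function.update D a D' i).indicator (1 : B i → ℝ≥0∞) (y i ω) =
          ∏ i ∈ S, (D i).indicator 1 (y i ω) := fun ω => Finset.prod_congr rfl fun i hi => by
        rw [Function.update_of_ne (ne_of_mem_of_not_mem hi haS)]
      have e2 : ∀ ω, ∏ i ∈ S, κ i (past ω) (Function.update D a D' i) =
          ∏ i ∈ S, κ i (past ω) (D i) := fun ω => Finset.prod_congr rfl fun i hi => by
        rw [Function.update_of_ne (ne_of_mem_of_not_mem hi haS)]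
      simp only [Finset.prod_insert haS, Function.update_self, e1, e2] at this
      rw [Measure.map_apply hpa (hC'.prod hD'), withDensity_apply _ (hpa (hC'.prod hD')),
        Measure.compProd_apply_prod hC' hD', setLIntegral_withDensity_eq_setLIntegral_mul _ hRm'
          ((κ a).measurable_coe hD') hC', setLIntegral_map hC'
          (hRm'.mul ((κ a).measurable_coe hD')) hp]
      have e3 : ∀ ω, (∏ i ∈ T, g i (past ω, y i ω)) *
          (D'.indicator 1 (y a ω) * ∏ i ∈ S, (D i).indicator 1 (y i ω)) =
            (y a ⁻¹' D').indicator R ω := fun ω => by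
        by_cases hω : y a ω ∈ D'
        · rw [Set.indicator_of_mem hω, Set.indicator_of_mem (show ω ∈ y a ⁻¹' D' from hω)]
          simp [hR]
        · rw [Set.indicator_of_notMem hω, Set.indicator_of_notMem (show ω ∉ y a ⁻¹' D' from hω)]
          simp
      simp_rw [e3] at this
      rw [setLIntegral_indicator (hy a hD'), Set.inter_comm] at this
      refine Eq.trans this (lintegral_congr fun ω => ?_)
      simp only [hR', Pi.mul_apply]
      ring
    have l1 : ∫⁻ x in C ×ˢ Set.univ, g a x ∂((P.withDensity R).map fun ω => (past ω, y a ω)) =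
        ∫⁻ ω in past ⁻¹' C, R ω * g a (past ω, y a ω) ∂P := by
      rw [setLIntegral_map (hC.prod MeasurableSet.univ) (hg a) hpa,
        setLIntegral_withDensity_eq_setLIntegral_mul _ hRm (hgy a)
          (hpa (hC.prod MeasurableSet.univ))]
      congr 2
      ext ω; simp
    have l2 : ∫⁻ x in C ×ˢ Set.univ, g a x ∂(((P.map past).withDensity R') ⊗ₘ κ a) =
        ∫⁻ ω in past ⁻¹' C, R' (past ω) * ∫⁻ b, g a (past ω, b) ∂(κ a (past ω)) ∂P := by
      rw [Measure.setLIntegral_compProd (hg a) hC MeasurableSet.univ]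
      simp_rw [Measure.restrict_univ]
      rw [setLIntegral_withDensity_eq_setLIntegral_mul _ hRm' (hgκ a) hC,
        setLIntegral_map hC (hRm'.mul (hgκ a)) hp]
      rfl
    rw [hρ, l2] at l1
    calc _ = ∫⁻ ω in past ⁻¹' C, R ω * g a (past ω, y a ω) ∂P := by
          refine lintegral_congr fun ω => ?_
          rw [Finset.prod_insert ha, hR]; ring
      _ = _ := by
          rw [← l1]
          refine lintegral_congr fun ω => ?_
          rw [Finset.prod_insert ha, hR']; ring

/-- Integrating out a countable conditionally independent family. -/
lemma CondIndepFamily.lintegral_expNeg_tsum [Countable ι] [IsProbabilityMeasure P]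
    (h : CondIndepFamily past y κ P) {f : ∀ i, A × B i → ℝ≥0∞} (hf : ∀ i, Measurable (f i)) :
    ∫⁻ ω, expNeg (∑' i, f i (past ω, y i ω)) ∂P =
      ∫⁻ ω, expNeg (∑' i, negLog (∫⁻ b, expNeg (f i (past ω, b)) ∂(κ i (past ω)))) ∂P := by
  have hp := h.measurable_past
  have hκ : ∀ᵐ ω ∂P, ∀ i, κ i (past ω) Set.univ = 1 := ae_all_iff.2 h.ae_eq_one
  -- Both sides are limits over finite index sets, dominated by `1`; `negLog` only serves to write
  -- an infinite product as the exponential of a sum. It inverts `expNeg` here because the kernels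
  -- have mass one almost surely.
  have hlim : ∀ F : ι → Ω → ℝ≥0∞, (∀ i, Measurable (F i)) →
      Tendsto (fun S : Finset ι => ∫⁻ ω, ∏ i ∈ S, expNeg (F i ω) ∂P) atTop
        (𝓝 (∫⁻ ω, expNeg (∑' i, F i ω) ∂P)) := fun F hF => by
    refine tendsto_lintegral_filter_of_dominated_convergence (fun _ => 1)
      (Eventually.of_forall fun S => ?_) (Eventually.of_forall fun S =>
        Eventually.of_forall fun ω => Finset.prod_le_one' fun i _ => expNeg_le_one _) (by simp)
      (Eventually.of_forall fun ω => tendsto_expNeg_sum _)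
    exact Finset.measurable_prod _ fun i _ => measurable_expNeg.comp (hF i)
  have hm : ∀ i, Measurable fun x => expNeg (f i x) := fun i => measurable_expNeg.comp (hf i)
  have hmκ : ∀ i, Measurable fun ω => ∫⁻ b, expNeg (f i (past ω, b)) ∂(κ i (past ω)) := fun i =>
    ((hm i).lintegral_kernel_prod_right' (κ := κ i)).comp hp
  refine tendsto_nhds_unique (hlim _ fun i => (hf i).comp (hp.prodMk (h.measurable i)))
    ((hlim _ fun i => measurable_negLog.comp (hmκ i)).congr fun S => ?_)
  have := h.setLIntegral_prod hm (fun i x => expNeg_le_one _) S ∅ (by simp) (fun _ => Set.univ)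
    (fun _ => MeasurableSet.univ) Set.univ MeasurableSet.univ
  simp only [Set.preimage_univ, Measure.restrict_univ, Finset.prod_empty, mul_one] at this
  rw [this]
  refine lintegral_congr_ae ?_
  filter_upwards [hκ] with ω hω
  refine Finset.prod_congr rfl fun i _ => expNeg_negLog ?_
  calc ∫⁻ b, expNeg (f i (past ω, b)) ∂(κ i (past ω)) ≤ ∫⁻ _, 1 ∂(κ i (past ω)) :=
        lintegral_mono fun b => expNeg_le_one _
    _ = 1 := by simp [hω i]

end CondIndep

/-! ### One generation of a marked cascade -/

section Tree

variable {𝒳 : ℕ → Type*} {Ω : Type*} {k : ℕ}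

/-- The marks on the path to a node of generation `l`, as a function of all the marks of
generations `1, …, l`. -/
def pastPath {l : ℕ} (a : Fin l → ℕ) (p : (j : Fin l) → (Fin (j + 1) → ℕ) → 𝒳 j) : Prefix 𝒳 l :=
  fun i => p i (Fin.take (i + 1) i.isLt a)

lemma pathMarks_eq_pastPath (z : (l : Fin k) → (Fin (l + 1) → ℕ) → Ω → 𝒳 l) (l : Fin k)
    (a : Fin l → ℕ) (ω : Ω) :
    pathMarks z l.isLt.le a ω = pastPath a (pastMarks z l ω) := rfl

lemma pathMarks_succ (z : (l : Fin k) → (Fin (l + 1) → ℕ) → Ω → 𝒳 l) (l : Fin k)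
    (a : Fin (l + 1) → ℕ) (ω : Ω) :
    pathMarks z (Nat.succ_le_of_lt l.isLt) a ω =
      extend (pathMarks z l.isLt.le (Fin.init (α := fun _ => ℕ) a) ω) (z l a ω) := by
  funext i
  refine Fin.lastCases ?_ (fun i => ?_) i
  · simp only [extend, Fin.snoc_last]; rfl
  · simp only [extend, Fin.snoc_castSucc]; rfl

variable [MeasurableSpace Ω] [∀ l, MeasurableSpace (𝒳 l)]

lemma measurable_pastPath {l : ℕ} (a : Fin l → ℕ) :
    Measurable (pastPath (𝒳 := 𝒳) a) :=
  measurable_pi_lambda _ fun i =>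
    (measurable_pi_apply (Fin.take (i + 1) i.isLt a)).comp (measurable_pi_apply i)

lemma measurable_extend {l : ℕ} :
    Measurable fun p : Prefix 𝒳 l × 𝒳 l => extend p.1 p.2 := by
  refine measurable_pi_lambda _ fun i => ?_
  refine Fin.lastCases ?_ (fun i => ?_) i
  · simp only [extend, Fin.snoc_last]; exact measurable_snd
  · simp only [extend, Fin.snoc_castSucc]
    exact (measurable_pi_apply i).comp measurable_fst

lemma measurable_pastMarks {z : (l : Fin k) → (Fin (l + 1) → ℕ) → Ω → 𝒳 l}
    (hz : ∀ l a, Measurable (z l a)) (l : Fin k) : Measurable (pastMarks z l) :=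
  measurable_pi_lambda _ fun _ => measurable_pi_lambda _ fun _ => hz _ _

lemma measurable_pathMarks {z : (l : Fin k) → (Fin (l + 1) → ℕ) → Ω → 𝒳 l}
    (hz : ∀ l a, Measurable (z l a)) {l : ℕ} (hl : l ≤ k) (a : Fin l → ℕ) :
    Measurable (pathMarks z hl a) :=
  measurable_pi_lambda _ fun _ => hz _ _

lemma measurable_family {z : (l : Fin k) → (Fin (l + 1) → ℕ) → Ω → 𝒳 l}
    (hz : ∀ l a, Measurable (z l a)) : Measurable fun ω l a => z l a ω :=
  measurable_pi_lambda _ fun _ => measurable_pi_lambda _ fun _ => hz _ _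

/-- The restriction of a family of marks to generations `1, …, l`. -/
def restrictPast (l : Fin k) (x : (l : Fin k) → (Fin (l + 1) → ℕ) → 𝒳 l) :
    (j : Fin l) → (Fin (j + 1) → ℕ) → 𝒳 j :=
  fun j a => x (j.castLE l.isLt.le) a

lemma measurable_restrictPast (l : Fin k) : Measurable (restrictPast (𝒳 := 𝒳) l) :=
  measurable_pi_lambda _ fun j => measurable_pi_lambda _ fun a =>
    (measurable_pi_apply a).comp (measurable_pi_apply (j.castLE l.isLt.le))

variable {κ : (l : Fin k) → Kernel (Prefix 𝒳 l) (𝒳 l)}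
  {z : (l : Fin k) → (Fin (l + 1) → ℕ) → Ω → 𝒳 l} {m : Fin k → ℝ}
  {u : (l : Fin k) → (Fin (l + 1) → ℕ) → Ω → ℝ} {P : Measure Ω}

/-- The joint law of the marks on the path to the parent of a node and the mark of this node. -/
lemma IsMarkProcess.map_eq_compProd [IsFiniteMeasure P] [∀ l, IsSFiniteKernel (κ l)]
    (hz : IsMarkProcess (fun l x => κ l x) z P) (l : Fin k) (a : Fin (l + 1) → ℕ) :
    P.map (fun ω => (pathMarks z l.isLt.le (Fin.init (α := fun _ => ℕ) a) ω, z l a ω)) =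
      (P.map (pathMarks z l.isLt.le (Fin.init (α := fun _ => ℕ) a))) ⊗ₘ κ l := by
  have hp := measurable_pathMarks hz.measurable l.isLt.le (Fin.init (α := fun _ => ℕ) a)
  refine Measure.ext_prod fun {C D} hC hD => ?_
  rw [Measure.map_apply (hp.prodMk (hz.measurable l a)) (hC.prod hD),
    Measure.compProd_apply_prod hC hD, setLIntegral_map hC ((κ l).measurable_coe hD) hp]
  have := hz.cond_law l (pastPath (Fin.init (α := fun _ => ℕ) a) ⁻¹' C) (measurable_pastPath _ hC)
    {a} (fun _ => D) fun _ => hD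
  simp only [Finset.mem_singleton, Set.iInter_iInter_eq_left, Finset.prod_singleton] at this
  exact this

/-- Given the points and the marks of the first generations, the marks of the next generation are
conditionally independent. -/
lemma IsMarkProcess.condIndepFamily [IsProbabilityMeasure P] [∀ l, IsSFiniteKernel (κ l)]
    (hum : ∀ l a, Measurable (u l a)) (hz : IsMarkProcess (fun l x => κ l x) z P)
    (huz : MarksIndep u z P) (l : Fin k) :
    CondIndepFamily (B := fun _ => 𝒳 l)
      (fun ω => ((fun l a => u l a ω : (l : Fin k) → (Fin (l + 1) → ℕ) → ℝ), pastMarks z l ω))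
      (fun a => z l a)
      (fun a => (κ l).comap (fun p => pastPath (Fin.init (α := fun _ => ℕ) a) p.2)
        ((measurable_pastPath _).comp measurable_snd)) P := by
  have hpm := measurable_pastMarks hz.measurable l
  have hU := measurable_family (𝒳 := fun _ => ℝ) hum
  have hUp := hU.prodMk hpm
  refine ⟨hUp, hz.measurable l, fun C hC S D hD => ?_⟩
  have hG : Measurable fun p : (j : Fin l) → (Fin (j + 1) → ℕ) → 𝒳 j =>
      ∏ a ∈ S, κ l (pastPath (Fin.init (α := fun _ => ℕ) a) p) (D a) :=
    Finset.measurable_prod _ fun a _ => ((κ l).measurable_coe (hD a)).comp (measurable_pastPath _)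
  -- Independence of points and marks gives the formula for products of an event of points and an
  -- event of past marks. Comparing two finite measures extends it to all joint events.
  have key : (P.restrict (⋂ a ∈ S, z l a ⁻¹' D a)).map
      (fun ω => ((fun l a => u l a ω : (l : Fin k) → (Fin (l + 1) → ℕ) → ℝ), pastMarks z l ω)) =
      (P.withDensity fun ω => ∏ a ∈ S,
        κ l (pastPath (Fin.init (α := fun _ => ℕ) a) (pastMarks z l ω)) (D a)).map
      (fun ω => ((fun l a => u l a ω : (l : Fin k) → (Fin (l + 1) → ℕ) → ℝ),
        pastMarks z l ω)) := by
    refine Measure.ext_prod fun {C₁ C₂} hC₁ hC₂ => ?_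
    have hset := hUp (hC₁.prod hC₂)
    rw [Measure.map_apply hUp (hC₁.prod hC₂), Measure.map_apply hUp (hC₁.prod hC₂),
      Measure.restrict_apply hset, withDensity_apply _ hset]
    have h1 : (⋂ a ∈ S, z l a ⁻¹' D a) ∩ pastMarks z l ⁻¹' C₂ =
        (fun ω l a => z l a ω) ⁻¹' ((⋂ a ∈ S, (fun x : (l : Fin k) → (Fin (l + 1) → ℕ) → 𝒳 l =>
          x l a) ⁻¹' D a) ∩ restrictPast l ⁻¹' C₂) := by
      rw [Set.preimage_inter]
      simp only [Set.preimage_iInter]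
      rfl
    have hT : MeasurableSet ((⋂ a ∈ S, (fun x : (l : Fin k) → (Fin (l + 1) → ℕ) → 𝒳 l =>
          x l a) ⁻¹' D a) ∩ restrictPast l ⁻¹' C₂) :=
      (S.measurableSet_biInter fun a _ =>
        ((measurable_pi_apply a).comp (measurable_pi_apply l)) (hD a)).inter
        (measurable_restrictPast l hC₂)
    have h2 := huz.measure_inter_preimage_eq_mul _ _ hC₁ hT
    rw [← h1, Set.inter_comm (⋂ a ∈ S, z l a ⁻¹' D a), hz.cond_law l C₂ hC₂ S D hD] at h2
    have h3 : IndepFun (fun ω => C₁.indicator (fun _ => (1 : ℝ≥0∞)) (fun l a => u l a ω))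
        (fun ω => C₂.indicator (fun p => ∏ a ∈ S,
          κ l (pastPath (Fin.init (α := fun _ => ℕ) a) p) (D a)) (pastMarks z l ω)) P :=
      huz.comp (φ := C₁.indicator (fun _ => (1 : ℝ≥0∞))) (ψ := fun x => C₂.indicator (fun p => ∏ a ∈ S,
          κ l (pastPath (Fin.init (α := fun _ => ℕ) a) p) (D a)) (restrictPast l x))
        (measurable_const.indicator hC₁) ((hG.indicator hC₂).comp (measurable_restrictPast l))
    have h4 := lintegral_mul_eq_lintegral_mul_lintegral_of_indepFun
      ((measurable_const.indicator hC₁).comp hU) ((hG.indicator hC₂).comp hpm) h3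
    have h5 : ∫⁻ ω, C₁.indicator (fun _ => (1 : ℝ≥0∞)) (fun l a => u l a ω) ∂P =
        P ((fun ω l a => u l a ω) ⁻¹' C₁) := by
      rw [← lintegral_indicator_one (hU hC₁)]; rfl
    have h6 : ∫⁻ ω, C₂.indicator (fun p => ∏ a ∈ S,
          κ l (pastPath (Fin.init (α := fun _ => ℕ) a) p) (D a)) (pastMarks z l ω) ∂P =
        ∫⁻ ω in pastMarks z l ⁻¹' C₂, ∏ a ∈ S,
          κ l (pastPath (Fin.init (α := fun _ => ℕ) a) (pastMarks z l ω)) (D a) ∂P := by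
      rw [← lintegral_indicator (hpm hC₂)]; rfl
    calc _ = P (((fun ω l a => u l a ω) ⁻¹' C₁) ∩
            (pastMarks z l ⁻¹' C₂ ∩ ⋂ a ∈ S, z l a ⁻¹' D a)) := by
          congr 1; ext ω; simp; tauto
      _ = _ := h2
      _ = _ := by
          rw [← h5]
          refine (congrArg _ h6.symm).trans (h4.symm.trans ?_)
          rw [← lintegral_indicator hset]
          refine lintegral_congr fun ω => ?_
          by_cases hω₁ : (fun l a => u l a ω) ∈ C₁ <;> by_cases hω₂ : pastMarks z l ω ∈ C₂ <;>
            simp [Set.indicator, hω₁, hω₂]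
  have := DFunLike.congr_fun key C
  rw [Measure.map_apply hUp hC, Measure.map_apply hUp hC, Measure.restrict_apply (hUp hC),
    withDensity_apply _ (hUp hC)] at this
  exact this

/-- The points of a generation are independent of the earlier generations. -/
lemma IsPoissonCascade.indepFun_past (hu : IsPoissonCascade m u P) (l : Fin k) :
    IndepFun (pastMarks (𝒳 := fun _ => ℝ) u l)
      (fun ω (p : Fin l → ℕ) (n : ℕ) => u l (Fin.snoc (α := fun _ => ℕ) p n) ω) P := by
  have hblock : ∀ q : Σ l : Fin k, (Fin l → ℕ), Measurable fun ω (n : ℕ) =>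
      u q.1 (Fin.snoc (α := fun _ => ℕ) q.2 n) ω := fun q =>
    measurable_pi_lambda _ fun n => hu.measurable _ _
  -- The blocks are indexed by parents. Those at levels below `l` and those at level `l` form
  -- disjoint index sets, and each earlier point is a coordinate of the block of its parent.
  have h := indep_iSup_of_disjoint (fun q => (hblock q).comap_le) hu.indep
    (S := {q | q.1 < l}) (T := {q | q.1 = l}) (by
      rw [Set.disjoint_left]
      intro q h1 h2
      exact (ne_of_lt h1) h2)
  refine indep_of_indep_of_le_left (indep_of_indep_of_le_right h ?_) ?_
  · rw [← measurable_iff_comap_le]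
    refine @measurable_pi_lambda _ _ _ (_) _ _ fun p => ?_
    rw [measurable_iff_comap_le]
    exact le_iSup₂_of_le (⟨l, p⟩ : Σ l : Fin k, (Fin l → ℕ)) rfl le_rfl
  · rw [← measurable_iff_comap_le]
    refine @measurable_pi_lambda _ _ _ (_) _ _ fun j => ?_
    refine @measurable_pi_lambda _ _ _ (_) _ _ fun a => ?_
    have h1 : @Measurable _ _ (⨆ q ∈ {q : Σ l : Fin k, (Fin l → ℕ) | q.1 < l},
        MeasurableSpace.comap (fun ω (n : ℕ) => u q.1 (Fin.snoc (α := fun _ => ℕ) q.2 n) ω)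
          inferInstance) _ (fun ω (n : ℕ) => u (j.castLE l.isLt.le)
            (Fin.snoc (α := fun _ => ℕ) (Fin.init (α := fun _ => ℕ) a) n) ω) := by
      rw [measurable_iff_comap_le]
      exact le_iSup₂_of_le (⟨j.castLE l.isLt.le, Fin.init (α := fun _ => ℕ) a⟩ :
        Σ l : Fin k, (Fin l → ℕ)) j.isLt le_rfl
    have h2 := (measurable_pi_apply (a (Fin.last _))).comp h1
    have h3 : (fun ω => pastMarks (𝒳 := fun _ => ℝ) u l ω j a) =
        (fun f : ℕ → ℝ => f (a (Fin.last _))) ∘ (fun ω (n : ℕ) => u (j.castLE l.isLt.le)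
            (Fin.snoc (α := fun _ => ℕ) (Fin.init (α := fun _ => ℕ) a) n) ω) := by
      funext ω
      simp only [Function.comp_apply, pastMarks]
      congr 1
      exact (Fin.snoc_init_self a).symm
    exact h3 ▸ h2

/-- Given the points of the first generations and the marks, the sequences of points of the next
generation are independent. -/
lemma IsPoissonCascade.condIndepFamily [IsProbabilityMeasure P] (hu : IsPoissonCascade m u P)
    (hzm : ∀ l a, Measurable (z l a)) (huz : MarksIndep u z P) (l : Fin k) :
    CondIndepFamily (B := fun _ => ℕ → ℝ)
      (fun ω => (pastMarks (𝒳 := fun _ => ℝ) u l ω,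
        (fun l a => z l a ω : (l : Fin k) → (Fin (l + 1) → ℕ) → 𝒳 l)))
      (fun (p : Fin l → ℕ) ω n => u l (Fin.snoc (α := fun _ => ℕ) p n) ω)
      (fun p => Kernel.const _
        (P.map fun ω (n : ℕ) => u l (Fin.snoc (α := fun _ => ℕ) p n) ω)) P := by
  have hpm := measurable_pastMarks (𝒳 := fun _ => ℝ) hu.measurable l
  have hZ := measurable_family hzm
  have hpZ := hpm.prodMk hZ
  have hy : ∀ p : Fin l → ℕ, Measurable fun ω (n : ℕ) =>
      u l (Fin.snoc (α := fun _ => ℕ) p n) ω := fun p =>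
    measurable_pi_lambda _ fun n => hu.measurable _ _
  refine ⟨hpZ, hy, fun C hC S D hD => ?_⟩
  set y : (Fin l → ℕ) → Ω → ℕ → ℝ := fun p ω n => u l (Fin.snoc (α := fun _ => ℕ) p n) ω
  have hprod : P (⋂ p ∈ S, y p ⁻¹' D p) = ∏ p ∈ S, P (y p ⁻¹' D p) := by
    have hinj : Function.Injective fun p : Fin l → ℕ => (⟨l, p⟩ : Σ l : Fin k, (Fin l → ℕ)) :=
      fun p q h => eq_of_heq (Sigma.mk.inj h).2
    exact (hu.indep.precomp hinj).measure_inter_preimage_eq_mul S fun p _ => hD p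
  -- Conditioning on an event of the new generation only multiplies the law of the earlier points
  -- and all the marks by a constant. Rectangles suffice: all points are independent of the marks,
  -- and the new points of the earlier ones.
  have key : (P.restrict (⋂ p ∈ S, y p ⁻¹' D p)).map
      (fun ω => (pastMarks (𝒳 := fun _ => ℝ) u l ω,
        (fun l a => z l a ω : (l : Fin k) → (Fin (l + 1) → ℕ) → 𝒳 l))) =
      (∏ p ∈ S, P (y p ⁻¹' D p)) • P.map (fun ω => (pastMarks (𝒳 := fun _ => ℝ) u l ω,
        (fun l a => z l a ω : (l : Fin k) → (Fin (l + 1) → ℕ) → 𝒳 l))) := by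
    refine Measure.ext_prod fun {C₁ C₂} hC₁ hC₂ => ?_
    have hset := hpZ (hC₁.prod hC₂)
    rw [Measure.smul_apply, Measure.map_apply hpZ (hC₁.prod hC₂),
      Measure.map_apply hpZ (hC₁.prod hC₂), Measure.restrict_apply hset, ← hprod]
    let Y : ((l : Fin k) → (Fin (l + 1) → ℕ) → ℝ) → (Fin l → ℕ) → ℕ → ℝ :=
      fun x p n => x l (Fin.snoc (α := fun _ => ℕ) p n)
    have hY : Measurable Y := measurable_pi_lambda _ fun p => measurable_pi_lambda _ fun n =>
      (measurable_pi_apply _).comp (measurable_pi_apply l)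
    have hTm : MeasurableSet (⋂ p ∈ S, (fun f : (Fin l → ℕ) → ℕ → ℝ => f p) ⁻¹' D p) :=
      S.measurableSet_biInter fun p _ => measurable_pi_apply p (hD p)
    have h1 := huz.measure_inter_preimage_eq_mul
      (restrictPast (𝒳 := fun _ => ℝ) l ⁻¹' C₁ ∩
        Y ⁻¹' (⋂ p ∈ S, (fun f : (Fin l → ℕ) → ℕ → ℝ => f p) ⁻¹' D p)) C₂
      ((measurable_restrictPast (𝒳 := fun _ => ℝ) l hC₁).inter (hY hTm)) hC₂
    have h2 := (hu.indepFun_past l).measure_inter_preimage_eq_mul C₁ _ hC₁ hTm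
    have h3 := huz.measure_inter_preimage_eq_mul
      (restrictPast (𝒳 := fun _ => ℝ) l ⁻¹' C₁) C₂
      (measurable_restrictPast (𝒳 := fun _ => ℝ) l hC₁) hC₂
    have e1 : (fun ω l a => u l a ω) ⁻¹' (restrictPast (𝒳 := fun _ => ℝ) l ⁻¹' C₁ ∩
        Y ⁻¹' (⋂ p ∈ S, (fun f : (Fin l → ℕ) → ℕ → ℝ => f p) ⁻¹' D p)) =
        pastMarks (𝒳 := fun _ => ℝ) u l ⁻¹' C₁ ∩
          (fun ω (p : Fin l → ℕ) (n : ℕ) => u l (Fin.snoc (α := fun _ => ℕ) p n) ω) ⁻¹'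
            (⋂ p ∈ S, (fun f : (Fin l → ℕ) → ℕ → ℝ => f p) ⁻¹' D p) := rfl
    have e2 : (fun ω (p : Fin l → ℕ) (n : ℕ) => u l (Fin.snoc (α := fun _ => ℕ) p n) ω) ⁻¹'
            (⋂ p ∈ S, (fun f : (Fin l → ℕ) → ℕ → ℝ => f p) ⁻¹' D p) = ⋂ p ∈ S, y p ⁻¹' D p := by
      simp only [Set.preimage_iInter]; rfl
    have e3 : (fun ω l a => u l a ω) ⁻¹' (restrictPast (𝒳 := fun _ => ℝ) l ⁻¹' C₁) =
        pastMarks (𝒳 := fun _ => ℝ) u l ⁻¹' C₁ := rfl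
    have e4 : (fun ω => (pastMarks (𝒳 := fun _ => ℝ) u l ω,
        (fun l a => z l a ω : (l : Fin k) → (Fin (l + 1) → ℕ) → 𝒳 l))) ⁻¹' (C₁ ×ˢ C₂) =
        pastMarks (𝒳 := fun _ => ℝ) u l ⁻¹' C₁ ∩ (fun ω l a => z l a ω) ⁻¹' C₂ := rfl
    rw [e1, h2, e2] at h1
    rw [e3] at h3
    rw [e4, smul_eq_mul, h3, Set.inter_right_comm, h1]
    ring
  have := DFunLike.congr_fun key C
  rw [Measure.smul_apply, Measure.map_apply hpZ hC, Measure.map_apply hpZ hC,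
    Measure.restrict_apply (hpZ hC)] at this
  rw [this]
  simp only [Kernel.const_apply]
  rw [setLIntegral_const, smul_eq_mul]
  congr 1
  exact Finset.prod_congr rfl fun p _ => (Measure.map_apply (hy p) (hD p)).symm

end Tree

/-! ### The Laplace functional of a marked cascade -/

section Laplace

variable {𝒳 : ℕ → Type*} {Ω : Type*} {k : ℕ}
  [MeasurableSpace Ω] [∀ l, MeasurableSpace (𝒳 l)]

/-- The points on the path to a node of generation `l`. -/
abbrev pathPoints (u : (l : Fin k) → (Fin (l + 1) → ℕ) → Ω → ℝ) {l : ℕ} (hl : l ≤ k)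
    (a : Fin l → ℕ) (ω : Ω) : Prefix (fun _ => ℝ) l :=
  pathMarks (𝒳 := fun _ => ℝ) u hl a ω

/-- The Laplace functional of the first `l` generations of a marked cascade. -/
noncomputable def laplace (u : (l : Fin k) → (Fin (l + 1) → ℕ) → Ω → ℝ)
    (z : (l : Fin k) → (Fin (l + 1) → ℕ) → Ω → 𝒳 l) (P : Measure Ω) {l : ℕ} (hl : l ≤ k)
    (f : Prefix (fun _ => ℝ) l × Prefix 𝒳 l → ℝ≥0∞) : ℝ≥0∞ :=
  ∫⁻ ω, expNeg (∑' a : Fin l → ℕ, f (pathPoints u hl a ω, pathMarks z hl a ω)) ∂P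

/-- The effect on test functions of integrating out the last generation. -/
noncomputable def levelStep {l : ℕ} (m : ℝ) (κ : Kernel (Prefix 𝒳 l) (𝒳 l))
    (f : Prefix (fun _ => ℝ) (l + 1) × Prefix 𝒳 (l + 1) → ℝ≥0∞)
    (p : Prefix (fun _ => ℝ) l × Prefix 𝒳 l) : ℝ≥0∞ :=
  ∫⁻ x, ∫⁻ y, (1 - expNeg (f (extend (𝒳 := fun _ => ℝ) p.1 x, extend p.2 y))) ∂(κ p.2)
    ∂(powerIntensity m)

instance (m : ℝ) : SFinite (powerIntensity m) := by
  unfold powerIntensity; infer_instance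

lemma measurable_extend_pair {l : ℕ} :
    Measurable fun q : ((Prefix (fun _ => ℝ) l × Prefix 𝒳 l) × ℝ) × 𝒳 l =>
      (extend (𝒳 := fun _ => ℝ) q.1.1.1 q.1.2, extend q.1.1.2 q.2) :=
  ((measurable_extend (𝒳 := fun _ => ℝ)).comp
    (measurable_fst.fst.fst.prodMk measurable_fst.snd)).prodMk
    (measurable_extend.comp (measurable_fst.fst.snd.prodMk measurable_snd))

lemma measurable_lintegral_extend {l : ℕ} (κ : Kernel (Prefix 𝒳 l) (𝒳 l)) [IsSFiniteKernel κ]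
    {F : Prefix (fun _ => ℝ) (l + 1) × Prefix 𝒳 (l + 1) → ℝ≥0∞} (hF : Measurable F) :
    Measurable fun q : (Prefix (fun _ => ℝ) l × Prefix 𝒳 l) × ℝ =>
      ∫⁻ y, F (extend (𝒳 := fun _ => ℝ) q.1.1 q.2, extend q.1.2 y) ∂(κ q.1.2) :=
  Measurable.lintegral_kernel_prod_right'
    (κ := κ.comap (fun q : (Prefix (fun _ => ℝ) l × Prefix 𝒳 l) × ℝ => q.1.2) measurable_fst.snd)
    (hF.comp measurable_extend_pair)

lemma measurable_levelStep {l : ℕ} (m : ℝ) (κ : Kernel (Prefix 𝒳 l) (𝒳 l)) [IsSFiniteKernel κ]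
    {f : Prefix (fun _ => ℝ) (l + 1) × Prefix 𝒳 (l + 1) → ℝ≥0∞} (hf : Measurable f) :
    Measurable (levelStep m κ f) :=
  Measurable.lintegral_prod_right' (measurable_lintegral_extend κ
    (F := fun p => 1 - expNeg (f p)) (measurable_const.sub (measurable_expNeg.comp hf)))

variable {κ : (l : Fin k) → Kernel (Prefix 𝒳 l) (𝒳 l)}
  {z : (l : Fin k) → (Fin (l + 1) → ℕ) → Ω → 𝒳 l} {m : Fin k → ℝ}
  {u : (l : Fin k) → (Fin (l + 1) → ℕ) → Ω → ℝ} {P : Measure Ω} [IsProbabilityMeasure P]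
  [∀ l, IsSFiniteKernel (κ l)]

lemma IsMarkProcess.ae_eq_one (hz : IsMarkProcess (fun l x => κ l x) z P) (l : Fin k)
    (p : Fin l → ℕ) :
    ∀ᵐ ω ∂P, κ l (pathMarks z l.isLt.le p ω) Set.univ = 1 := by
  -- Constant dummy points are independent of any marks, and the choice of child `0` below is
  -- arbitrary.
  have hu : ∀ (l : Fin k) (a : Fin (l + 1) → ℕ), Measurable fun _ : Ω => (0 : ℝ) :=
    fun _ _ => measurable_const
  have h := (hz.condIndepFamily (u := fun _ _ _ => 0) hu (indepFun_const_left _ _) l).ae_eq_one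
    (Fin.snoc (α := fun _ => ℕ) p 0)
  filter_upwards [h] with ω hω
  simpa [Kernel.comap_apply, pathMarks_eq_pastPath] using hω

/-- Integrating out the last generation of a marked cascade. -/
lemma laplace_succ (hu : IsPoissonCascade m u P) (hz : IsMarkProcess (fun l x => κ l x) z P)
    (huz : MarksIndep u z P) (l : Fin k)
    {f : Prefix (fun _ => ℝ) (l + 1) × Prefix 𝒳 (l + 1) → ℝ≥0∞} (hf : Measurable f) :
    laplace u z P (Nat.succ_le_of_lt l.isLt) f =
      laplace u z P l.isLt.le (levelStep (m l) (κ l) f) := by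
  -- `G` is what remains of `f` once the new mark is averaged out with all the points kept fixed: a
  -- function of the parent's path and the new point.
  let G : (Prefix (fun _ => ℝ) l × Prefix 𝒳 l) × ℝ → ℝ≥0∞ := fun q =>
    negLog (∫⁻ y, expNeg (f (extend (𝒳 := fun _ => ℝ) q.1.1 q.2, extend q.1.2 y)) ∂(κ l q.1.2))
  have hG : Measurable G := measurable_negLog.comp
    (measurable_lintegral_extend (κ l) (measurable_expNeg.comp hf))
  -- the marks of the last generation
  have h1 := (hz.condIndepFamily hu.measurable huz l).lintegral_expNeg_tsum
    (f := fun (a : Fin (l + 1) → ℕ) q => f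
      (extend (𝒳 := fun _ => ℝ) (pastPath (𝒳 := fun _ => ℝ) (Fin.init (α := fun _ => ℕ) a)
          (restrictPast (𝒳 := fun _ => ℝ) l q.1.1)) (q.1.1 l a),
        extend (pastPath (Fin.init (α := fun _ => ℕ) a) q.1.2) q.2)) (fun a => by
      refine hf.comp (Measurable.prodMk ?_ ?_)
      · exact (measurable_extend (𝒳 := fun _ => ℝ)).comp
          (((measurable_pastPath (𝒳 := fun _ => ℝ) _).comp
            ((measurable_restrictPast (𝒳 := fun _ => ℝ) l).comp measurable_fst.fst)).prodMk
            ((measurable_pi_apply a).comp ((measurable_pi_apply l).comp measurable_fst.fst)))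
      · exact measurable_extend.comp
          (((measurable_pastPath _).comp measurable_fst.snd).prodMk measurable_snd))
  have h2 : laplace u z P (Nat.succ_le_of_lt l.isLt) f =
      ∫⁻ ω, expNeg (∑' a : Fin (l + 1) → ℕ, G ((pathPoints u l.isLt.le
        (Fin.init (α := fun _ => ℕ) a) ω, pathMarks z l.isLt.le
          (Fin.init (α := fun _ => ℕ) a) ω), u l a ω)) ∂P := by
    refine Eq.trans (lintegral_congr fun ω => ?_) h1
    congr 1
    refine tsum_congr fun a => ?_
    rw [pathPoints, pathMarks_succ z, pathMarks_succ (𝒳 := fun _ => ℝ) u]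
    rfl
  -- Siblings share the path of their parent, so grouping nodes by parent leaves one functional of a
  -- Poisson sequence for each parent.
  have h3 : ∀ ω, ∑' a : Fin (l + 1) → ℕ, G ((pathPoints u l.isLt.le
        (Fin.init (α := fun _ => ℕ) a) ω, pathMarks z l.isLt.le
          (Fin.init (α := fun _ => ℕ) a) ω), u l a ω) =
      ∑' p : Fin l → ℕ, ∑' n : ℕ, G ((pathPoints u l.isLt.le p ω, pathMarks z l.isLt.le p ω),
        u l (Fin.snoc (α := fun _ => ℕ) p n) ω) := fun ω => by
    rw [← (Fin.snocEquiv fun _ : Fin (l + 1) => ℕ).tsum_eq, ENNReal.tsum_prod', ENNReal.tsum_comm]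
    refine tsum_congr fun p => tsum_congr fun n => ?_
    change G ((pathPoints u l.isLt.le (Fin.init (α := fun _ => ℕ)
        (Fin.snoc (α := fun _ => ℕ) p n)) ω, pathMarks z l.isLt.le (Fin.init (α := fun _ => ℕ)
          (Fin.snoc (α := fun _ => ℕ) p n)) ω), u l (Fin.snoc (α := fun _ => ℕ) p n) ω) = _
    rw [Fin.init_snoc]
  simp_rw [h3] at h2
  -- the points of the last generation
  have h4 := (hu.condIndepFamily hz.measurable huz l).lintegral_expNeg_tsum
    (f := fun (p : Fin l → ℕ) q => ∑' n : ℕ, G ((pastPath (𝒳 := fun _ => ℝ) p q.1.1,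
      pastPath p (restrictPast l q.1.2)), q.2 n)) (fun p => by
      refine Measurable.tsum fun n => hG.comp (Measurable.prodMk (Measurable.prodMk ?_ ?_) ?_)
      · exact (measurable_pastPath (𝒳 := fun _ => ℝ) p).comp measurable_fst.fst
      · exact (measurable_pastPath p).comp ((measurable_restrictPast l).comp measurable_fst.snd)
      · exact (measurable_pi_apply n).comp measurable_snd)
  have hy : ∀ p : Fin l → ℕ, Measurable fun ω (n : ℕ) =>
      u l (Fin.snoc (α := fun _ => ℕ) p n) ω := fun p =>
    measurable_pi_lambda _ fun n => hu.measurable _ _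
  rw [h2]
  refine h4.trans (lintegral_congr_ae ?_)
  filter_upwards [ae_all_iff.2 (hz.ae_eq_one l)] with ω hω
  congr 1
  refine tsum_congr fun p => ?_
  have : IsProbabilityMeasure (κ l (pathMarks z l.isLt.le p ω)) := ⟨hω p⟩
  have hGp : Measurable fun x => G ((pathPoints u l.isLt.le p ω, pathMarks z l.isLt.le p ω), x) :=
    hG.comp (measurable_const.prodMk measurable_id)
  have hGs : Measurable fun s : ℕ → ℝ => expNeg (∑' n, G ((pathPoints u l.isLt.le p ω,
      pathMarks z l.isLt.le p ω), s n)) :=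
    measurable_expNeg.comp (Measurable.tsum fun n => hGp.comp (measurable_pi_apply n))
  refine (congrArg negLog ((lintegral_map hGs (hy p)).trans
    ((hu.poisson l p).lintegral_expNeg (fun n => hu.measurable _ _) hGp))).trans ?_
  -- The Poisson formula leaves `1 - exp (-G)`; since the kernel has mass one at this path, this is
  -- the average of `1 - exp (-f)` over the new mark.
  rw [negLog_expNeg]
  refine lintegral_congr fun x => ?_
  have hm : Measurable fun y => expNeg (f (extend (𝒳 := fun _ => ℝ) (pathPoints u l.isLt.le p ω) x,
      extend (pathMarks z l.isLt.le p ω) y)) :=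
    measurable_expNeg.comp (hf.comp (measurable_const.prodMk
      (measurable_extend.comp (measurable_const.prodMk measurable_id))))
  have hle : ∫⁻ y, expNeg (f (extend (𝒳 := fun _ => ℝ) (pathPoints u l.isLt.le p ω) x,
      extend (pathMarks z l.isLt.le p ω) y)) ∂(κ l (pathMarks z l.isLt.le p ω)) ≤ 1 :=
    (lintegral_mono fun y => expNeg_le_one _).trans (by simp)
  rw [expNeg_negLog hle, lintegral_sub hm (hle.trans_lt ENNReal.one_lt_top).ne
    (Eventually.of_forall fun y => expNeg_le_one _)]
  simp

omit [∀ l, MeasurableSpace (𝒳 l)] [IsProbabilityMeasure P] in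
lemma laplace_congr {l : ℕ} (hl : l ≤ k)
    {f g : Prefix (fun _ => ℝ) l × Prefix 𝒳 l → ℝ≥0∞}
    (h : ∀ a : Fin l → ℕ, ∀ᵐ ω ∂P, f (pathPoints u hl a ω, pathMarks z hl a ω) =
      g (pathPoints u hl a ω, pathMarks z hl a ω)) :
    laplace u z P hl f = laplace u z P hl g := by
  refine lintegral_congr_ae ?_
  filter_upwards [ae_all_iff.2 h] with ω hω
  simp_rw [hω]

omit [∀ l, MeasurableSpace (𝒳 l)] in
lemma laplace_zero (f : Prefix (fun _ => ℝ) 0 × Prefix 𝒳 0 → ℝ≥0∞) :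
    laplace u z P (Nat.zero_le k) f = expNeg (f (fun i => i.elim0, fun i => i.elim0)) := by
  have : ∀ ω (a : Fin 0 → ℕ), f (pathPoints u (Nat.zero_le k) a ω,
      pathMarks z (Nat.zero_le k) a ω) = f (fun i => i.elim0, fun i => i.elim0) := fun ω a => by
    congr 2 <;> exact Subsingleton.elim _ _
  simp [laplace, this]

end Laplace

/-! ### Scaling of the power intensity -/

lemma ae_powerIntensity_pos (m : ℝ) : ∀ᵐ x ∂(powerIntensity m), 0 < x :=
  (withDensity_absolutelyContinuous _ _).ae_le (ae_restrict_mem measurableSet_Ioi)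

lemma lintegral_powerIntensity (m : ℝ) {F : ℝ → ℝ≥0∞} (hF : Measurable F) :
    ∫⁻ x, F x ∂(powerIntensity m) =
      ∫⁻ x in Set.Ioi 0, ENNReal.ofReal (x ^ (-1 - m)) * F x := by
  rw [powerIntensity, lintegral_withDensity_eq_lintegral_mul _ (by fun_prop) hF]
  rfl

/-- Change of variables: the density contributes `e ^ (1 + m)` and Lebesgue measure `e⁻¹`. This
scaling is the source of every invariance below. -/
lemma lintegral_powerIntensity_mul (m : ℝ) {e : ℝ} (he : 0 < e) {F : ℝ → ℝ≥0∞}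
    (hF : Measurable F) :
    ∫⁻ x, F (x * e) ∂(powerIntensity m) =
      ENNReal.ofReal (e ^ m) * ∫⁻ x, F x ∂(powerIntensity m) := by
  have hcomp : Measurable fun x => F (x * e) := hF.comp (measurable_id.mul_const e)
  have hw : Measurable fun x : ℝ => ENNReal.ofReal (x ^ (-1 - m)) := by fun_prop
  rw [lintegral_powerIntensity m hcomp, lintegral_powerIntensity m hF,
    ← lintegral_indicator measurableSet_Ioi, ← lintegral_indicator measurableSet_Ioi]
  set H : ℝ → ℝ≥0∞ := (Set.Ioi (0 : ℝ)).indicator fun x => ENNReal.ofReal (x ^ (-1 - m)) * F x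
    with hH
  have hHm : Measurable H := (hw.mul hF).indicator measurableSet_Ioi
  have h1 : ∀ x, (Set.Ioi (0 : ℝ)).indicator
      (fun x => ENNReal.ofReal (x ^ (-1 - m)) * F (x * e)) x =
        ENNReal.ofReal (e ^ (1 + m)) * H (x * e) := fun x => by
    by_cases hx : 0 < x
    · have hxe : 0 < x * e := mul_pos hx he
      rw [hH, Set.indicator_of_mem (show x ∈ Set.Ioi (0 : ℝ) from hx),
        Set.indicator_of_mem (show x * e ∈ Set.Ioi (0 : ℝ) from hxe), ← mul_assoc,
        ← ENNReal.ofReal_mul (by positivity)]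
      congr 2
      rw [Real.mul_rpow hx.le he.le, mul_left_comm, ← Real.rpow_add he]
      simp
    · have hxe : ¬ 0 < x * e := fun h => hx (pos_of_mul_pos_left h he.le)
      rw [hH, Set.indicator_of_notMem (show x ∉ Set.Ioi (0 : ℝ) from hx),
        Set.indicator_of_notMem (show x * e ∉ Set.Ioi (0 : ℝ) from hxe), mul_zero]
  simp_rw [h1]
  have hHe : Measurable fun x => H (x * e) := hHm.comp (measurable_id.mul_const e)
  rw [lintegral_const_mul _ hHe]
  have h2 : ∫⁻ x, H (x * e) = ENNReal.ofReal e⁻¹ * ∫⁻ x, H x := by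
    have := Real.map_volume_mul_right he.ne'
    rw [← lintegral_map (g := fun x : ℝ => x * e) hHm (measurable_id.mul_const e), this,
      lintegral_smul_measure, abs_of_pos (inv_pos.2 he), smul_eq_mul]
  rw [h2, ← mul_assoc, ← ENNReal.ofReal_mul (by positivity), ← Real.rpow_neg_one,
    ← Real.rpow_add he]
  congr 3; ring

/-! ### Reweighting -/

section Reweighting

variable {𝒳 : ℕ → Type*} [∀ l, MeasurableSpace (𝒳 l)] {k : ℕ} {m : Fin k → ℝ}
  {ν : (l : Fin k) → Kernel (Prefix 𝒳 l) (𝒳 l)} [∀ l, IsMarkovKernel (ν l)]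
  {X : Prefix 𝒳 k → ℝ}

lemma measurable_levelFun (m : Fin k → ℝ) (ν : (l : Fin k) → Kernel (Prefix 𝒳 l) (𝒳 l))
    [∀ l, IsMarkovKernel (ν l)] (hX : Measurable X) {l : ℕ} (hl : l ≤ k) :
    Measurable (levelFun m ν X hl) := by
  refine Nat.decreasingInduction (motive := fun j hj => Measurable (levelFun m ν X hj)) ?_ ?_ hl
  · intro j hj ih
    have h1 : Measurable fun p : Prefix 𝒳 j × 𝒳 j =>
        Real.exp (m ⟨j, hj⟩ * levelFun m ν X hj (extend p.1 p.2)) :=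
      Real.measurable_exp.comp ((ih.comp measurable_extend).const_mul _)
    have h2 := (h1.stronglyMeasurable.integral_kernel_prod_right' (κ := ν ⟨j, hj⟩)).measurable
    have h3 : levelFun m ν X hj.le = fun x => 1 / m ⟨j, hj⟩ * Real.log
        (∫ y, Real.exp (m ⟨j, hj⟩ * levelFun m ν X hj (extend x y)) ∂(ν ⟨j, hj⟩ x)) :=
      funext fun x => levelFun_of_lt m ν X ⟨j, hj⟩ x
    rw [h3]
    exact (Real.measurable_log.comp h2).const_mul _
  · rw [levelFun_self]
    exact hX

/-- The quotient of the values of `exp X` at consecutive generations. -/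
noncomputable def ratio (m : Fin k → ℝ) (ν : (l : Fin k) → Kernel (Prefix 𝒳 l) (𝒳 l))
    (X : Prefix 𝒳 k → ℝ) (l : Fin k) (x : Prefix 𝒳 l) (y : 𝒳 l) : ℝ :=
  Real.exp (levelFun m ν X (Nat.succ_le_of_lt l.isLt) (extend x y) - levelFun m ν X l.isLt.le x)

omit [∀ l, IsMarkovKernel (ν l)] in
lemma ratio_pos (l : Fin k) (x : Prefix 𝒳 l) (y : 𝒳 l) : 0 < ratio m ν X l x y := Real.exp_pos _

omit [∀ l, IsMarkovKernel (ν l)] in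
-- The scaling factor produced by the intensity is precisely the density used to reweight the marks.
lemma ratio_rpow (l : Fin k) (x : Prefix 𝒳 l) (y : 𝒳 l) :
    ratio m ν X l x y ^ m l = weight m ν X l x y := by
  rw [ratio, weight, ← Real.exp_mul, mul_comm]

lemma measurable_ratio (m : Fin k → ℝ) (ν : (l : Fin k) → Kernel (Prefix 𝒳 l) (𝒳 l))
    [∀ l, IsMarkovKernel (ν l)] (hX : Measurable X) (l : Fin k) :
    Measurable fun p : Prefix 𝒳 l × 𝒳 l => ratio m ν X l p.1 p.2 :=
  Real.measurable_exp.comp (((measurable_levelFun m ν hX _).comp measurable_extend).sub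
    ((measurable_levelFun m ν hX _).comp measurable_fst))

lemma measurable_weight (m : Fin k → ℝ) (ν : (l : Fin k) → Kernel (Prefix 𝒳 l) (𝒳 l))
    [∀ l, IsMarkovKernel (ν l)] (hX : Measurable X) (l : Fin k) :
    Measurable fun p : Prefix 𝒳 l × 𝒳 l => weight m ν X l p.1 p.2 := by
  simp_rw [← ratio_rpow]
  exact (measurable_ratio m ν hX l).pow_const _

/-- The reweighted conditional distributions as a kernel. -/
noncomputable def reweightedKernel (m : Fin k → ℝ)
    (ν : (l : Fin k) → Kernel (Prefix 𝒳 l) (𝒳 l)) [∀ l, IsMarkovKernel (ν l)]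
    (X : Prefix 𝒳 k → ℝ) (l : Fin k) : Kernel (Prefix 𝒳 l) (𝒳 l) :=
  (ν l).withDensity fun x y => ENNReal.ofReal (weight m ν X l x y)

instance (l : Fin k) : IsSFiniteKernel (reweightedKernel m ν X l) := by
  exact Kernel.IsSFiniteKernel.withDensity (ν l) fun _ _ => ENNReal.ofReal_ne_top

lemma measurable_levelStep_reweightedKernel (l : Fin k)
    {f : Prefix (fun _ => ℝ) (l + 1) × Prefix 𝒳 (l + 1) → ℝ≥0∞} (hf : Measurable f) :
    Measurable (levelStep (m l) (reweightedKernel m ν X l) f) :=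
  measurable_levelStep _ _ hf

lemma reweightedKernel_apply (hX : Measurable X) (l : Fin k) (x : Prefix 𝒳 l) :
    reweightedKernel m ν X l x = reweighted m ν X l x :=
  Kernel.withDensity_apply _ (measurable_weight m ν hX l).ennreal_ofReal x

/-- The increments along a path with given marks. -/
noncomputable def pathRatio (m : Fin k → ℝ) (ν : (l : Fin k) → Kernel (Prefix 𝒳 l) (𝒳 l))
    (X : Prefix 𝒳 k → ℝ) {l : ℕ} (hl : l ≤ k) (x : Prefix 𝒳 l) (i : Fin l) : ℝ :=
  ratio m ν X (i.castLE hl) (fun j => x (j.castLE i.isLt.le)) (x i)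

omit [∀ l, IsMarkovKernel (ν l)] in
lemma pathRatio_castSucc (l : Fin k) (x : Prefix 𝒳 l) (y : 𝒳 l) (i : Fin l) :
    pathRatio m ν X (Nat.succ_le_of_lt l.isLt) (extend x y) i.castSucc =
      pathRatio m ν X l.isLt.le x i := by
  have h : ∀ j : Fin l, extend x y j.castSucc = x j := fun j => by
    simp only [extend, Fin.snoc_castSucc]
  have h1 : (fun j : Fin i => extend x y ((j.castLE i.isLt.le).castSucc)) =
      fun j : Fin i => x (j.castLE i.isLt.le) := funext fun j => h _
  unfold pathRatio
  rw [h]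
  exact congrArg (fun t => ratio m ν X (i.castLE l.isLt.le) t (x i)) h1

omit [∀ l, IsMarkovKernel (ν l)] in
lemma pathRatio_last (l : Fin k) (x : Prefix 𝒳 l) (y : 𝒳 l) :
    pathRatio m ν X (Nat.succ_le_of_lt l.isLt) (extend x y) (Fin.last l) = ratio m ν X l x y := by
  have h1 : (fun j : Fin l => extend x y j.castSucc) = x := funext fun j => by
    simp only [extend, Fin.snoc_castSucc]
  have h2 : extend x y (Fin.last l) = y := by simp only [extend, Fin.snoc_last]
  unfold pathRatio
  rw [h2]
  exact congrArg (fun t => ratio m ν X l t y) h1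

lemma measurable_pathRatio (m : Fin k → ℝ) (ν : (l : Fin k) → Kernel (Prefix 𝒳 l) (𝒳 l))
    [∀ l, IsMarkovKernel (ν l)] (hX : Measurable X) {l : ℕ} (hl : l ≤ k) (i : Fin l) :
    Measurable fun x => pathRatio m ν X hl x i :=
  (measurable_ratio m ν hX (i.castLE hl)).comp
    (f := fun x : Prefix 𝒳 l => ((fun j => x (j.castLE i.isLt.le), x i) : Prefix 𝒳 i × 𝒳 i))
    ((measurable_pi_lambda _ fun _ => measurable_pi_apply _).prodMk (measurable_pi_apply i))

/-- The points multiplied by the increments along a path with given marks. -/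
noncomputable def rescale (m : Fin k → ℝ) (ν : (l : Fin k) → Kernel (Prefix 𝒳 l) (𝒳 l))
    (X : Prefix 𝒳 k → ℝ) {l : ℕ} (hl : l ≤ k) (p : Prefix (fun _ => ℝ) l × Prefix 𝒳 l) :
    Prefix (fun _ => ℝ) l :=
  fun i => p.1 i * pathRatio m ν X hl p.2 i

lemma measurable_rescale (m : Fin k → ℝ) (ν : (l : Fin k) → Kernel (Prefix 𝒳 l) (𝒳 l))
    [∀ l, IsMarkovKernel (ν l)] (hX : Measurable X) {l : ℕ} (hl : l ≤ k) :
    Measurable (rescale m ν X hl) :=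
  measurable_pi_lambda _ fun i => ((measurable_pi_apply i).comp measurable_fst).mul
    ((measurable_pathRatio m ν hX hl i).comp measurable_snd)

omit [∀ l, IsMarkovKernel (ν l)] in
lemma rescale_extend (l : Fin k) (s : Prefix (fun _ => ℝ) l) (t : ℝ) (x : Prefix 𝒳 l) (y : 𝒳 l) :
    rescale m ν X (Nat.succ_le_of_lt l.isLt) (extend (𝒳 := fun _ => ℝ) s t, extend x y) =
      extend (𝒳 := fun _ => ℝ) (rescale m ν X l.isLt.le (s, x)) (t * ratio m ν X l x y) := by
  funext i
  refine Fin.lastCases ?_ (fun i => ?_) i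
  · simp only [rescale, pathRatio_last]
    simp only [extend, Fin.snoc_last]
  · simp only [rescale, pathRatio_castSucc]
    simp only [extend, Fin.snoc_castSucc]
    rfl

/-- Multiplying the points of a marked Poisson process by functions of the marks amounts to
reweighting the marks. -/
lemma lintegral_powerIntensity_mul_withDensity {E : Type*} [MeasurableSpace E] (μ : Measure E)
    [SFinite μ] (m : ℝ) {r : E → ℝ} (hr : Measurable r) (hr0 : ∀ y, 0 < r y)
    {F : ℝ → E → ℝ≥0∞} (hF : Measurable (Function.uncurry F)) :
    ∫⁻ t, ∫⁻ y, F (t * r y) y ∂μ ∂(powerIntensity m) =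
      ∫⁻ t, ∫⁻ y, F t y ∂(μ.withDensity fun y => ENNReal.ofReal (r y ^ m))
        ∂(powerIntensity m) := by
  have hw : Measurable fun y => ENNReal.ofReal (r y ^ m) := (hr.pow_const m).ennreal_ofReal
  have hFy : ∀ t, Measurable (F t) := fun t => hF.comp (measurable_const.prodMk measurable_id)
  have hFt : ∀ y, Measurable fun t => F t y := fun y =>
    hF.comp (measurable_id.prodMk measurable_const)
  have h1 : Measurable (Function.uncurry fun t y => F (t * r y) y) :=
    hF.comp ((measurable_fst.mul (hr.comp measurable_snd)).prodMk measurable_snd)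
  have h2 : Measurable (Function.uncurry fun y t => ENNReal.ofReal (r y ^ m) * F t y) :=
    (hw.comp measurable_fst).mul (hF.comp measurable_swap)
  -- With the mark on the outside, the multiplier is a constant for the inner integral and the
  -- scaling applies; a second exchange restores the order.
  rw [lintegral_lintegral_swap h1.aemeasurable]
  simp_rw [fun y => lintegral_powerIntensity_mul m (hr0 y) (hFt y),
    ← fun y => lintegral_const_mul (μ := powerIntensity m) (ENNReal.ofReal (r y ^ m)) (hFt y)]
  rw [lintegral_lintegral_swap h2.aemeasurable]
  refine lintegral_congr fun t => ?_
  rw [lintegral_withDensity_eq_lintegral_mul _ hw (hFy t)]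
  rfl

/-- The multiplier of the new point becomes a density on the new mark, while the multipliers of the
earlier points depend only on `p` and pass through. This is the theorem for one generation. -/
lemma levelStep_rescale (hX : Measurable X) (l : Fin k)
    {f : Prefix (fun _ => ℝ) (l + 1) × Prefix 𝒳 (l + 1) → ℝ≥0∞} (hf : Measurable f)
    (p : Prefix (fun _ => ℝ) l × Prefix 𝒳 l) :
    levelStep (m l) (ν l)
        (fun q => f (rescale m ν X (Nat.succ_le_of_lt l.isLt) q, q.2)) p =
      levelStep (m l) (reweightedKernel m ν X l) f (rescale m ν X l.isLt.le p, p.2) := by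
  have hF : Measurable (Function.uncurry fun (t : ℝ) (y : 𝒳 l) =>
      1 - expNeg (f (extend (𝒳 := fun _ => ℝ) (rescale m ν X l.isLt.le p) t, extend p.2 y))) :=
    measurable_const.sub (measurable_expNeg.comp (hf.comp
      (((measurable_extend (𝒳 := fun _ => ℝ)).comp (measurable_const.prodMk measurable_fst)).prodMk
        (measurable_extend.comp (measurable_const.prodMk measurable_snd)))))
  have h := lintegral_powerIntensity_mul_withDensity (ν l p.2) (m l)
    ((measurable_ratio m ν hX l).comp (measurable_const.prodMk measurable_id))
    (fun y => ratio_pos l p.2 y) hF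
  simp only [Function.comp_apply, id, ratio_rpow] at h
  simp only [levelStep, rescale_extend, reweightedKernel_apply hX, reweighted]
  exact h

variable {Ω Ω' : Type*} [MeasurableSpace Ω] [MeasurableSpace Ω'] {P : Measure Ω} {P' : Measure Ω'}
  [IsProbabilityMeasure P] [IsProbabilityMeasure P']
  {u : (l : Fin k) → (Fin (l + 1) → ℕ) → Ω → ℝ} {z : (l : Fin k) → (Fin (l + 1) → ℕ) → Ω → 𝒳 l}
  {u' : (l : Fin k) → (Fin (l + 1) → ℕ) → Ω' → ℝ}
  {z' : (l : Fin k) → (Fin (l + 1) → ℕ) → Ω' → 𝒳 l}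

/-- Integrating out the last generation on both sides leaves the same statement one level higher,
with the reweighted step of `f` as new test function; hence the quantification over `f`. -/
lemma laplace_rescale (hX : Measurable X) (hu : IsPoissonCascade m u P)
    (hz : IsMarkProcess (fun l x => ν l x) z P) (huz : MarksIndep u z P)
    (hu' : IsPoissonCascade m u' P') (hz' : IsMarkProcess (reweighted m ν X) z' P')
    (huz' : MarksIndep u' z' P') {l : ℕ} (hl : l ≤ k) :
    ∀ {f : Prefix (fun _ => ℝ) l × Prefix 𝒳 l → ℝ≥0∞}, Measurable f →
      laplace u z P hl (fun p => f (rescale m ν X hl p, p.2)) = laplace u' z' P' hl f := by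
  have hz'' : IsMarkProcess (fun l x => reweightedKernel m ν X l x) z' P' := by
    simp_rw [reweightedKernel_apply hX]; exact hz'
  induction l with
  | zero =>
    intro f hf
    rw [laplace_zero, laplace_zero]
    congr 3
    exact Subsingleton.elim _ _
  | succ n ih =>
    intro f hf
    have h1 := laplace_succ hu hz huz ⟨n, hl⟩ (f := fun q => f (rescale m ν X hl q, q.2))
      (hf.comp ((measurable_rescale m ν hX hl).prodMk measurable_snd))
    have h2 := laplace_succ hu' hz'' huz' ⟨n, hl⟩ hf
    refine h1.trans (Eq.trans ?_ h2.symm)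
    refine Eq.trans ?_ (ih (Nat.le_of_succ_le hl)
      (measurable_levelStep_reweightedKernel (m := m) (ν := ν) (X := X) ⟨n, hl⟩ hf))
    congr 1
    funext p
    exact levelStep_rescale hX ⟨n, hl⟩ hf p

/-! ### Integrability and normalization -/

omit [∀ l, IsMarkovKernel (ν l)] in
-- Positivity rules out the default value `0` of a divergent integral, for which the logarithm would
-- be meaningless.
lemma exp_levelFun_of_lt (hm0 : ∀ l, 0 < m l) (l : Fin k) (x : Prefix 𝒳 l)
    (hpos : 0 < ∫ y, Real.exp (m l * levelFun m ν X (Nat.succ_le_of_lt l.isLt) (extend x y))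
      ∂(ν l x)) :
    Real.exp (m l * levelFun m ν X l.isLt.le x) =
      ∫ y, Real.exp (m l * levelFun m ν X (Nat.succ_le_of_lt l.isLt) (extend x y)) ∂(ν l x) := by
  rw [levelFun_of_lt, ← mul_assoc, mul_one_div_cancel (hm0 l).ne', one_mul, Real.exp_log hpos]

/-- Jensen for the concave power `p`, obtained from Hölder against the constant `1` with exponents
`1 / p` and `1 / (1 - p)`. -/
lemma lintegral_rpow_le_rpow_lintegral {E : Type*} [MeasurableSpace E] {μ : Measure E}
    [IsProbabilityMeasure μ] {f : E → ℝ≥0∞} (hf : Measurable f) {p : ℝ} (hp0 : 0 < p)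
    (hp1 : p < 1) : ∫⁻ x, f x ^ p ∂μ ≤ (∫⁻ x, f x ∂μ) ^ p := by
  have hc : Real.HolderConjugate (1 / p) (1 / (1 - p)) := by
    rw [Real.holderConjugate_iff]
    refine ⟨by rw [lt_div_iff₀ hp0]; simpa using hp1, by simp⟩
  have h := ENNReal.lintegral_mul_le_Lp_mul_Lq μ hc (f := fun x => f x ^ p) (g := fun _ => 1)
    (hf.pow_const p).aemeasurable aemeasurable_const
  simp only [Pi.mul_apply, mul_one, ENNReal.one_rpow, lintegral_const, measure_univ] at h
  simpa [← ENNReal.rpow_mul, hp0.ne'] using h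

/-- The estimate of `exp X` at a generation by its mean at the next generation, and the
normalization of the weights. -/
lemma levelFun_normalization (hm0 : ∀ l, 0 < m l) (hm1 : ∀ l, m l < 1) (hX : Measurable X)
    (l : Fin k) (x : Prefix 𝒳 l)
    (hI : ∫⁻ y, ENNReal.ofReal (Real.exp (levelFun m ν X (Nat.succ_le_of_lt l.isLt)
      (extend x y))) ∂(ν l x) < ∞) :
    ENNReal.ofReal (Real.exp (levelFun m ν X l.isLt.le x)) ≤
        ∫⁻ y, ENNReal.ofReal (Real.exp (levelFun m ν X (Nat.succ_le_of_lt l.isLt)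
          (extend x y))) ∂(ν l x) ∧
      ∫⁻ y, ENNReal.ofReal (weight m ν X l x y) ∂(ν l x) = 1 := by
  have hmp := hm0 l
  set g : 𝒳 l → ℝ := fun y => levelFun m ν X (Nat.succ_le_of_lt l.isLt) (extend x y) with hg
  have hgm : Measurable g := (measurable_levelFun m ν hX _).comp
    (measurable_extend.comp (measurable_const.prodMk measurable_id))
  have hem : Measurable fun y => ENNReal.ofReal (Real.exp (g y)) :=
    (Real.measurable_exp.comp hgm).ennreal_ofReal
  have hrp : ∀ y, ENNReal.ofReal (Real.exp (g y)) ^ m l =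
      ENNReal.ofReal (Real.exp (m l * g y)) := fun y => by
    rw [ENNReal.ofReal_rpow_of_pos (Real.exp_pos _), ← Real.exp_mul, mul_comm]
  have hJI := lintegral_rpow_le_rpow_lintegral (μ := ν l x) hem hmp (hm1 l)
  simp_rw [hrp] at hJI
  set J := ∫⁻ y, ENNReal.ofReal (Real.exp (m l * g y)) ∂(ν l x) with hJ
  set I := ∫⁻ y, ENNReal.ofReal (Real.exp (g y)) ∂(ν l x)
  -- Finiteness of the mean of `exp g` passes to `exp (m g)`, so the Bochner integral in `levelFun`
  -- is genuine and equals `J`.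
  have hJtop : J ≠ ∞ := (hJI.trans_lt (ENNReal.rpow_lt_top_of_nonneg hmp.le hI.ne)).ne
  have hemm : Measurable fun y => Real.exp (m l * g y) :=
    Real.measurable_exp.comp (hgm.const_mul _)
  have hint : Integrable (fun y => Real.exp (m l * g y)) (ν l x) := by
    refine ⟨hemm.aestronglyMeasurable, ?_⟩
    rw [hasFiniteIntegral_iff_ofReal (Eventually.of_forall fun y => (Real.exp_pos _).le)]
    exact hJtop.lt_top
  have hJint : ENNReal.ofReal (∫ y, Real.exp (m l * g y) ∂(ν l x)) = J :=
    ofReal_integral_eq_lintegral_ofReal hint (Eventually.of_forall fun y => (Real.exp_pos _).le)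
  have hpos : 0 < ∫ y, Real.exp (m l * g y) ∂(ν l x) := integral_exp_pos hint
  have hexp := exp_levelFun_of_lt hm0 l x hpos
  have hexpJ : ENNReal.ofReal (Real.exp (m l * levelFun m ν X l.isLt.le x)) = J := by
    rw [hexp, hJint]
  constructor
  · rw [← ENNReal.rpow_le_rpow_iff hmp, ENNReal.ofReal_rpow_of_pos (Real.exp_pos _),
      ← Real.exp_mul, mul_comm, hexpJ]
    exact hJI
  · have h1 : ∀ y, ENNReal.ofReal (weight m ν X l x y) =
        ENNReal.ofReal (Real.exp (m l * levelFun m ν X l.isLt.le x))⁻¹ *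
          ENNReal.ofReal (Real.exp (m l * g y)) := fun y => by
      rw [← ENNReal.ofReal_mul (by positivity), weight, mul_sub, Real.exp_sub, hg]
      congr 1
      rw [div_eq_inv_mul]
    simp_rw [h1]
    rw [lintegral_const_mul _ hemm.ennreal_ofReal, ← hJ, ← hexpJ,
      ← ENNReal.ofReal_mul (by positivity), inv_mul_cancel₀ (Real.exp_pos _).ne',
      ENNReal.ofReal_one]

/-- Disintegration of the joint law of a parent's path and one child's mark; the child `0` is an
arbitrary choice. -/
lemma lintegral_exp_levelFun_succ (hX : Measurable X)
    (hz : IsMarkProcess (fun l x => ν l x) z P) (l : Fin k) (p : Fin l → ℕ) :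
    ∫⁻ ω, ENNReal.ofReal (Real.exp (levelFun m ν X (Nat.succ_le_of_lt l.isLt)
        (pathMarks z (Nat.succ_le_of_lt l.isLt) (Fin.snoc (α := fun _ => ℕ) p 0) ω))) ∂P =
      ∫⁻ ω, ∫⁻ y, ENNReal.ofReal (Real.exp (levelFun m ν X (Nat.succ_le_of_lt l.isLt)
        (extend (pathMarks z l.isLt.le p ω) y))) ∂(ν l (pathMarks z l.isLt.le p ω)) ∂P := by
  have h := hz.map_eq_compProd l (Fin.snoc (α := fun _ => ℕ) p 0)
  rw [Fin.init_snoc] at h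
  have hp := measurable_pathMarks hz.measurable l.isLt.le p
  have hF : Measurable fun q : Prefix 𝒳 l × 𝒳 l => ENNReal.ofReal (Real.exp
      (levelFun m ν X (Nat.succ_le_of_lt l.isLt) (extend q.1 q.2))) :=
    (Real.measurable_exp.comp
      ((measurable_levelFun m ν hX _).comp measurable_extend)).ennreal_ofReal
  have h1 := congrArg (fun M => ∫⁻ q, ENNReal.ofReal (Real.exp
      (levelFun m ν X (Nat.succ_le_of_lt l.isLt) (extend q.1 q.2))) ∂M) h
  rw [lintegral_map hF (hp.prodMk (hz.measurable l _)), Measure.lintegral_compProd hF,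
    lintegral_map hF.lintegral_kernel_prod_right' hp] at h1
  rw [← h1]
  refine lintegral_congr fun ω => ?_
  rw [pathMarks_succ, Fin.init_snoc]

lemma lintegral_exp_levelFun_lt_top (hm0 : ∀ l, 0 < m l) (hm1 : ∀ l, m l < 1) (hX : Measurable X)
    (hz : IsMarkProcess (fun l x => ν l x) z P)
    (hexp : ∀ α : Fin k → ℕ, Integrable (fun ω => Real.exp (X (pathMarks z le_rfl α ω))) P)
    {l : ℕ} (hl : l ≤ k) : ∀ a : Fin l → ℕ,
    ∫⁻ ω, ENNReal.ofReal (Real.exp (levelFun m ν X hl (pathMarks z hl a ω))) ∂P < ∞ := by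
  refine Nat.decreasingInduction (motive := fun j hj => ∀ a : Fin j → ℕ,
    ∫⁻ ω, ENNReal.ofReal (Real.exp (levelFun m ν X hj (pathMarks z hj a ω))) ∂P < ∞) ?_ ?_ hl
  · intro j hj ih p
    have h1 := ih (Fin.snoc (α := fun _ => ℕ) p 0)
    refine lt_of_le_of_lt ?_ h1
    rw [lintegral_exp_levelFun_succ hX hz ⟨j, hj⟩ p]
    refine lintegral_mono fun ω => ?_
    -- Where the inner integral diverges, `levelFun` may be a default value, but the bound by `∞` is
    -- trivial.
    by_cases hI : ∫⁻ y, ENNReal.ofReal (Real.exp (levelFun m ν X (Nat.succ_le_of_lt hj)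
        (extend (pathMarks z hj.le p ω) y))) ∂(ν ⟨j, hj⟩ (pathMarks z hj.le p ω)) < ∞
    · exact (levelFun_normalization hm0 hm1 hX ⟨j, hj⟩ _ hI).1
    · exact le_top.trans_eq (not_lt_top_iff.1 hI).symm
  · intro a
    rw [levelFun_self]
    exact (hasFiniteIntegral_iff_ofReal (Eventually.of_forall fun y => (Real.exp_pos _).le)).1
      (hexp a).2

/-- A finite mean at the next generation makes the inner integral finite for almost every path, and
there the density is normalized. -/
lemma ae_lintegral_weight_eq_one (hm0 : ∀ l, 0 < m l) (hm1 : ∀ l, m l < 1) (hX : Measurable X)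
    (hz : IsMarkProcess (fun l x => ν l x) z P)
    (hexp : ∀ α : Fin k → ℕ, Integrable (fun ω => Real.exp (X (pathMarks z le_rfl α ω))) P)
    (l : Fin k) (p : Fin l → ℕ) :
    ∀ᵐ ω ∂P, reweightedKernel m ν X l (pathMarks z l.isLt.le p ω) Set.univ = 1 := by
  have h1 := lintegral_exp_levelFun_lt_top hm0 hm1 hX hz hexp (Nat.succ_le_of_lt l.isLt)
    (Fin.snoc (α := fun _ => ℕ) p 0)
  rw [lintegral_exp_levelFun_succ hX hz l p] at h1
  have hF : Measurable fun q : Prefix 𝒳 l × 𝒳 l => ENNReal.ofReal (Real.exp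
      (levelFun m ν X (Nat.succ_le_of_lt l.isLt) (extend q.1 q.2))) :=
    (Real.measurable_exp.comp
      ((measurable_levelFun m ν hX _).comp measurable_extend)).ennreal_ofReal
  have h2 := ae_lt_top ((hF.lintegral_kernel_prod_right' (κ := ν l)).comp
    (measurable_pathMarks hz.measurable l.isLt.le p)) h1.ne
  filter_upwards [h2] with ω hω
  rw [reweightedKernel_apply hX, reweighted, withDensity_apply _ MeasurableSet.univ,
    Measure.restrict_univ]
  exact (levelFun_normalization hm0 hm1 hX l _ hω).2

/-! ### The products of the points along a path -/

/-- The effect of integrating out one generation on test functions of the product of the points. -/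
noncomputable def radialStep (m : ℝ) (h : ℝ → ℝ≥0∞) (s : ℝ) : ℝ≥0∞ :=
  ∫⁻ x, (1 - expNeg (h (s * x))) ∂(powerIntensity m)

lemma measurable_radialStep (m : ℝ) {h : ℝ → ℝ≥0∞} (hh : Measurable h) :
    Measurable (radialStep m h) := by
  have : Measurable fun q : ℝ × ℝ => 1 - expNeg (h (q.1 * q.2)) :=
    measurable_const.sub (measurable_expNeg.comp (hh.comp (measurable_fst.mul measurable_snd)))
  exact this.lintegral_prod_right'

lemma prod_extend {l : ℕ} (s : Prefix (fun _ => ℝ) l) (t : ℝ) :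
    ∏ i, extend (𝒳 := fun _ => ℝ) s t i = (∏ i, s i) * t := by
  rw [Fin.prod_univ_castSucc]
  simp only [extend, Fin.snoc_castSucc, Fin.snoc_last]

/-- The integrand does not depend on the new mark, so the kernel enters only through its mass. -/
lemma levelStep_prod {l : ℕ} (m : ℝ) (κ : Kernel (Prefix 𝒳 l) (𝒳 l)) (h : ℝ → ℝ≥0∞)
    (p : Prefix (fun _ => ℝ) l × Prefix 𝒳 l) (hp : κ p.2 Set.univ = 1) :
    levelStep m κ (fun q => h (∏ i, q.1 i)) p = radialStep m h (∏ i, p.1 i) := by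
  simp only [levelStep, radialStep, prod_extend, lintegral_const, hp, mul_one]

lemma measurable_prod_fst {l : ℕ} :
    Measurable fun p : Prefix (fun _ => ℝ) l × Prefix 𝒳 l => ∏ i, p.1 i :=
  Finset.measurable_prod _ fun i _ => (measurable_pi_apply i).comp measurable_fst

lemma laplace_prod_succ (hu : IsPoissonCascade m u P)
    (hz : IsMarkProcess (fun l x => ν l x) z P) (huz : MarksIndep u z P) (l : Fin k)
    {h : ℝ → ℝ≥0∞} (hh : Measurable h) :
    laplace u z P (Nat.succ_le_of_lt l.isLt) (fun q => h (∏ i, q.1 i)) =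
      laplace u z P l.isLt.le (fun q => radialStep (m l) h (∏ i, q.1 i)) := by
  refine (laplace_succ hu hz huz l (f := fun q => h (∏ i, q.1 i))
    (hh.comp measurable_prod_fst)).trans ?_
  congr 1
  funext p
  exact levelStep_prod _ _ _ _ measure_univ

/-- Rescaling replaces the kernel by the reweighted one, of mass one almost surely, which a function
of the product cannot distinguish from the original. Both sides thus reduce to the same radial step,
and everything stays on the original marks. -/
lemma laplace_prod_rescale (hm0 : ∀ l, 0 < m l) (hm1 : ∀ l, m l < 1) (hX : Measurable X)
    (hu : IsPoissonCascade m u P) (hz : IsMarkProcess (fun l x => ν l x) z P)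
    (huz : MarksIndep u z P)
    (hexp : ∀ α : Fin k → ℕ, Integrable (fun ω => Real.exp (X (pathMarks z le_rfl α ω))) P)
    {l : ℕ} (hl : l ≤ k) : ∀ {h : ℝ → ℝ≥0∞}, Measurable h →
      laplace u z P hl (fun p => h (∏ i, rescale m ν X hl p i)) =
        laplace u z P hl (fun p => h (∏ i, p.1 i)) := by
  induction l with
  | zero =>
    intro h hh
    simp
  | succ n ih =>
    intro h hh
    have h1 := laplace_succ hu hz huz ⟨n, hl⟩ (f := fun q => h (∏ i, rescale m ν X hl q i))
      (hh.comp ((measurable_prod_fst (𝒳 := 𝒳)).comp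
        ((measurable_rescale m ν hX hl).prodMk measurable_snd)))
    refine h1.trans (Eq.trans ?_ (laplace_prod_succ hu hz huz ⟨n, hl⟩ hh).symm)
    refine Eq.trans ?_ (ih (Nat.le_of_succ_le hl) (measurable_radialStep (m ⟨n, hl⟩) hh))
    refine laplace_congr _ fun p => ?_
    filter_upwards [ae_lintegral_weight_eq_one hm0 hm1 hX hz hexp ⟨n, hl⟩ p] with ω hω
    refine (levelStep_rescale hX ⟨n, hl⟩ (f := fun q => h (∏ i, q.1 i))
      (hh.comp measurable_prod_fst) _).trans ?_
    exact levelStep_prod _ _ _ _ hω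

end Reweighting

/-! ### Moments of the total mass -/

lemma one_sub_expNeg_le (x : ℝ≥0∞) : 1 - expNeg x ≤ x := by
  rcases eq_or_ne x ∞ with rfl | hx
  · exact le_top
  · rw [← ENNReal.ofReal_toReal hx, expNeg_ofReal ENNReal.toReal_nonneg, ← ENNReal.ofReal_one,
      ← ENNReal.ofReal_sub _ (Real.exp_pos _).le]
    exact ENNReal.ofReal_le_ofReal (by linarith [Real.add_one_le_exp (-x.toReal)])

lemma expNeg_lt_one {x : ℝ≥0∞} (hx : x ≠ 0) : expNeg x < 1 := by
  rw [← expNeg_zero]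
  exact expNeg_strictAnti (pos_iff_ne_zero.2 hx)

/-- The integral of `1 - exp (-C x ^ b)` with respect to the intensity `x ^ (-1 - a) dx`. -/
noncomputable def powerConst (C : ℝ≥0∞) (b a : ℝ) : ℝ≥0∞ :=
  ∫⁻ x, (1 - expNeg (C * ENNReal.ofReal x ^ b)) ∂(powerIntensity a)

lemma measurable_one_sub_expNeg_rpow (C : ℝ≥0∞) (b : ℝ) :
    Measurable fun x : ℝ => 1 - expNeg (C * ENNReal.ofReal x ^ b) :=
  measurable_const.sub (measurable_expNeg.comp
    ((ENNReal.measurable_ofReal.pow_const b).const_mul C))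

/-- Near `0` the integrand is at most `C x ^ (b - 1 - a)`, integrable because `a < b`; at infinity
it is at most `x ^ (-1 - a)`, integrable because `a > 0`. -/
lemma powerConst_ne_top {C : ℝ≥0∞} (hC : C ≠ ∞) {a b : ℝ} (ha : 0 < a) (hab : a < b) :
    powerConst C b a ≠ ∞ := by
  rw [powerConst, lintegral_powerIntensity a (measurable_one_sub_expNeg_rpow C b)]
  have hsub : Set.Ioi (0 : ℝ) ⊆ Set.Ioo 0 2 ∪ Set.Ioi 1 := fun x hx => by
    rcases lt_or_ge x 2 with h | h
    · exact Or.inl ⟨hx, h⟩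
    · exact Or.inr (lt_of_lt_of_le one_lt_two h)
  have h1 : ∫⁻ x in Set.Ioo (0 : ℝ) 2, ENNReal.ofReal (x ^ (-1 - a)) *
      (1 - expNeg (C * ENNReal.ofReal x ^ b)) < ∞ := by
    have hi : IntegrableOn (fun x : ℝ => x ^ (b - 1 - a)) (Set.Ioo 0 2) :=
      (intervalIntegral.integrableOn_Ioo_rpow_iff two_pos).2 (by linarith)
    have hfin : ∫⁻ x in Set.Ioo (0 : ℝ) 2, C * ENNReal.ofReal (x ^ (b - 1 - a)) < ∞ := by
      rw [lintegral_const_mul _ (by fun_prop)]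
      refine ENNReal.mul_lt_top hC.lt_top ?_
      refine (setLIntegral_mono' measurableSet_Ioo fun x _ => ?_).trans_lt hi.2
      exact Real.ofReal_le_enorm _
    refine (setLIntegral_mono' measurableSet_Ioo fun x hx => ?_).trans_lt hfin
    refine (mul_le_mul_right (one_sub_expNeg_le _) _).trans ?_
    rw [ENNReal.ofReal_rpow_of_pos hx.1, mul_left_comm,
      ← ENNReal.ofReal_mul (Real.rpow_nonneg hx.1.le _), ← Real.rpow_add hx.1]
    exact le_of_eq (by ring_nf)
  have h2 : ∫⁻ x in Set.Ioi (1 : ℝ), ENNReal.ofReal (x ^ (-1 - a)) *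
      (1 - expNeg (C * ENNReal.ofReal x ^ b)) < ∞ := by
    have hi : IntegrableOn (fun x : ℝ => x ^ (-1 - a)) (Set.Ioi 1) :=
      integrableOn_Ioi_rpow_of_lt (by linarith) one_pos
    refine (setLIntegral_mono' measurableSet_Ioi fun x hx => ?_).trans_lt hi.2
    refine (mul_le_mul_right tsub_le_self _).trans ?_
    rw [mul_one]
    exact Real.ofReal_le_enorm _
  exact ((lintegral_mono_set hsub).trans (lintegral_union_le _ _ _)).trans_lt
    (ENNReal.add_lt_top.2 ⟨h1, h2⟩) |>.ne

lemma powerConst_ne_zero {C : ℝ≥0∞} (hC : C ≠ 0) (a b : ℝ) : powerConst C b a ≠ 0 := by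
  rw [powerConst, lintegral_powerIntensity a (measurable_one_sub_expNeg_rpow C b)]
  intro h
  have hm : Measurable fun x : ℝ => ENNReal.ofReal (x ^ (-1 - a)) *
      (1 - expNeg (C * ENNReal.ofReal x ^ b)) :=
    Measurable.mul (by fun_prop) (measurable_one_sub_expNeg_rpow C b)
  have h0 := (lintegral_eq_zero_iff hm).1 h
  have hF : ∀ᵐ x ∂(volume.restrict (Set.Ioi (0 : ℝ))), False := by
    filter_upwards [h0, ae_restrict_mem measurableSet_Ioi] with x hx hx0
    have hx0' : (0 : ℝ) < x := hx0
    simp only [Pi.zero_apply, mul_eq_zero, ENNReal.ofReal_eq_zero] at hx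
    rcases hx with hx | hx
    · exact absurd hx (not_le.2 (Real.rpow_pos_of_pos hx0' _))
    · refine absurd (tsub_eq_zero_iff_le.1 hx) (not_le.2 (expNeg_lt_one ?_))
      rw [ENNReal.ofReal_rpow_of_pos hx0']
      exact mul_ne_zero hC (ENNReal.ofReal_pos.2 (Real.rpow_pos_of_pos hx0' _)).ne'
  rw [ae_iff] at hF
  simp at hF

/-- By scaling, power functions are stable under the radial step, which turns the exponent `b` into
`m`. For `s ≤ 0` truncation makes both sides vanish. -/
lemma radialStep_power {C : ℝ≥0∞} {b m t : ℝ} (hb : 0 < b) (hm : 0 < m) (ht : 0 < t) (s : ℝ) :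
    radialStep m (fun s => C * ENNReal.ofReal (t * s) ^ b) s =
      powerConst C b m * ENNReal.ofReal (t * s) ^ m := by
  rcases lt_or_ge 0 s with hs | hs
  · have hts := mul_pos ht hs
    have := lintegral_powerIntensity_mul m hts (measurable_one_sub_expNeg_rpow C b)
    rw [ENNReal.ofReal_rpow_of_pos hts, mul_comm, powerConst, ← this]
    refine lintegral_congr fun x => ?_
    simp only [mul_left_comm x t s, mul_comm x s]
  · have hz : ENNReal.ofReal (t * s) = 0 :=
      ENNReal.ofReal_of_nonpos (mul_nonpos_of_nonneg_of_nonpos ht.le hs)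
    rw [hz, ENNReal.zero_rpow_of_pos hm, mul_zero, radialStep]
    have h0 : ∀ᵐ x ∂(powerIntensity m),
        1 - expNeg (C * ENNReal.ofReal (t * (s * x)) ^ b) = 0 := by
      filter_upwards [ae_powerIntensity_pos m] with x hx
      have : ENNReal.ofReal (t * (s * x)) = 0 := ENNReal.ofReal_of_nonpos
        (mul_nonpos_of_nonneg_of_nonpos ht.le (mul_nonpos_of_nonpos_of_nonneg hs hx.le))
      rw [this, ENNReal.zero_rpow_of_pos hb]
      simp
    rw [lintegral_congr_ae h0, lintegral_zero]

/-! ### Moments of a variable with Laplace transform `exp (-C t ^ b)` -/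

section StableLaw

variable {Ω : Type*} [MeasurableSpace Ω] {P : Measure Ω} [IsProbabilityMeasure P] {V : Ω → ℝ≥0∞}

/-- The integral of `exp (-t v)` over `t > 0` is `1 / v`; it turns the Laplace transform into a
bound for the moment of order `-1`. -/
lemma inv_le_lintegral_expNeg (v : ℝ≥0∞) :
    v⁻¹ ≤ ∫⁻ t in Set.Ioi (0 : ℝ), expNeg (ENNReal.ofReal t * v) := by
  rcases eq_or_ne v 0 with rfl | hv0
  · simp
  rcases eq_or_ne v ∞ with rfl | hv
  · simp
  obtain ⟨r, hr0, rfl⟩ : ∃ r : ℝ, 0 < r ∧ v = ENNReal.ofReal r :=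
    ⟨v.toReal, ENNReal.toReal_pos hv0 hv, (ENNReal.ofReal_toReal hv).symm⟩
  have h1 : ∀ t ∈ Set.Ioi (0 : ℝ), ENNReal.ofReal (Real.exp (-r * t)) =
      expNeg (ENNReal.ofReal t * ENNReal.ofReal r) := fun t ht => by
    have ht' : (0 : ℝ) < t := ht
    rw [← ENNReal.ofReal_mul ht'.le, expNeg_ofReal (by positivity)]
    congr 2; ring
  rw [← setLIntegral_congr_fun measurableSet_Ioi h1, ← ofReal_integral_eq_lintegral_ofReal
    (integrableOn_exp_mul_Ioi (neg_lt_zero.2 hr0) 0)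
    (Eventually.of_forall fun t => (Real.exp_pos _).le), integral_exp_mul_Ioi (neg_lt_zero.2 hr0),
    ← ENNReal.ofReal_inv_of_pos hr0]
  simp

/-- Scaling by `v` gives equality for finite positive `v`, and `v = ∞` follows by a limit along the
integers. It expresses the moment of order `a` through the Laplace transform. -/
lemma powerConst_mul_rpow_le {a : ℝ} (ha : 0 < a) (v : ℝ≥0∞) :
    powerConst 1 1 a * v ^ a ≤
      ∫⁻ x, (1 - expNeg (ENNReal.ofReal x * v)) ∂(powerIntensity a) := by
  have hfin : ∀ r : ℝ, 0 < r → powerConst 1 1 a * ENNReal.ofReal r ^ a =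
      ∫⁻ x, (1 - expNeg (ENNReal.ofReal x * ENNReal.ofReal r)) ∂(powerIntensity a) := fun r hr => by
    have := lintegral_powerIntensity_mul a hr (measurable_one_sub_expNeg_rpow 1 1)
    rw [ENNReal.ofReal_rpow_of_pos hr, mul_comm, powerConst, ← this]
    refine lintegral_congr fun x => ?_
    rw [one_mul, ENNReal.rpow_one, ENNReal.ofReal_mul' hr.le]
  rcases eq_or_ne v 0 with rfl | hv0
  · simp [ENNReal.zero_rpow_of_pos ha]
  rcases eq_or_ne v ∞ with rfl | hv
  · have hlim : Tendsto (fun n : ℕ => powerConst 1 1 a * (n : ℝ≥0∞) ^ a) atTop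
        (𝓝 (powerConst 1 1 a * ∞ ^ a)) := by
      refine ENNReal.Tendsto.const_mul
        ((ENNReal.continuous_rpow_const.tendsto _).comp ENNReal.tendsto_nat_nhds_top) (Or.inl ?_)
      simp [ENNReal.top_rpow_of_pos ha]
    refine le_of_tendsto' hlim fun n => ?_
    rcases Nat.eq_zero_or_pos n with rfl | hn
    · simp [ENNReal.zero_rpow_of_pos ha]
    · rw [← ENNReal.ofReal_natCast, hfin n (by exact_mod_cast hn)]
      exact lintegral_mono fun x => tsub_le_tsub_left (expNeg_antitone
        (mul_le_mul_right le_top _)) _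
  · rw [← ENNReal.ofReal_toReal hv, hfin _ (ENNReal.toReal_pos hv0 hv)]

/-- A random variable whose Laplace transform is `exp (-C t ^ b)` is positive and finite, and its
logarithm is integrable. -/
lemma log_integrable_of_laplace (hV : Measurable V) {C : ℝ≥0∞} {b : ℝ} (hC0 : C ≠ 0)
    (hC : C ≠ ∞) (hb : 0 < b) (hb1 : b ≤ 1)
    (h : ∀ t : ℝ, 0 < t →
      ∫⁻ ω, expNeg (ENNReal.ofReal t * V ω) ∂P = expNeg (C * ENNReal.ofReal t ^ b)) :
    (∀ᵐ ω ∂P, V ω ≠ 0 ∧ V ω ≠ ∞) ∧ Integrable (fun ω => Real.log (V ω).toReal) P := by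
  -- Any exponent strictly between `0` and `b` would do: the moment of order `a` is bounded through
  -- `powerConst C b a`, finite for `a < b`.
  set a := b / 2 with ha_def
  have ha : 0 < a := by positivity
  have hab : a < b := by rw [ha_def]; linarith
  have hm : Measurable fun q : Ω × ℝ => expNeg (ENNReal.ofReal q.2 * V q.1) :=
    measurable_expNeg.comp
      ((ENNReal.measurable_ofReal.comp measurable_snd).mul (hV.comp measurable_fst))
  have hinv : ∫⁻ ω, (V ω)⁻¹ ∂P < ∞ := by
    refine (lintegral_mono fun ω => inv_le_lintegral_expNeg (V ω)).trans_lt ?_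
    rw [lintegral_lintegral_swap hm.aemeasurable, setLIntegral_congr_fun measurableSet_Ioi h]
    have hc : 0 < C.toReal := ENNReal.toReal_pos hC0 hC
    have hi := integrableOn_rpow_mul_exp_neg_mul_rpow (s := 0) (by norm_num) hb hc
    refine (setLIntegral_mono' measurableSet_Ioi fun t ht => ?_).trans_lt hi.2
    have ht' : (0 : ℝ) < t := ht
    nth_rw 1 [← ENNReal.ofReal_toReal hC]
    rw [ENNReal.ofReal_rpow_of_pos ht', ← ENNReal.ofReal_mul hc.le, expNeg_ofReal (by positivity)]
    simp only [Real.rpow_zero, one_mul, neg_mul]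
    exact Real.ofReal_le_enorm _
  have hpow : ∫⁻ ω, V ω ^ a ∂P < ∞ := by
    have hK0 := powerConst_ne_zero one_ne_zero a 1
    have hKtop : powerConst 1 1 a ≠ ∞ := powerConst_ne_top ENNReal.one_ne_top ha (by linarith)
    have h1 : powerConst 1 1 a * ∫⁻ ω, V ω ^ a ∂P ≤ powerConst C b a := by
      rw [← lintegral_const_mul _ (hV.pow_const a)]
      refine (lintegral_mono fun ω => powerConst_mul_rpow_le ha (V ω)).trans ?_
      have hm' : Measurable (Function.uncurry fun (ω : Ω) (x : ℝ) =>
          1 - expNeg (ENNReal.ofReal x * V ω)) := measurable_const.sub hm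
      rw [lintegral_lintegral_swap hm'.aemeasurable, powerConst]
      refine lintegral_mono_ae ?_
      filter_upwards [ae_powerIntensity_pos a] with x hx
      have hmx : Measurable fun ω => expNeg (ENNReal.ofReal x * V ω) :=
        measurable_expNeg.comp (hV.const_mul _)
      rw [lintegral_sub hmx (by rw [h x hx]; exact expNeg_ne_top _)
        (Eventually.of_forall fun ω => expNeg_le_one _), h x hx]
      simp
    refine lt_of_le_of_lt ?_ ((ENNReal.div_lt_top (powerConst_ne_top hC ha hab) hK0))
    rw [ENNReal.le_div_iff_mul_le (Or.inl hK0) (Or.inl hKtop), mul_comm]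
    exact h1
  have hVae : ∀ᵐ ω ∂P, V ω ≠ 0 ∧ V ω ≠ ∞ := by
    filter_upwards [ae_lt_top hV.inv hinv.ne, ae_lt_top (hV.pow_const a) hpow.ne] with ω h1 h2
    refine ⟨fun h0 => ?_, fun htop => ?_⟩
    · simp [h0] at h1
    · simp [htop, ENNReal.top_rpow_of_pos ha] at h2
  refine ⟨hVae, (Real.measurable_log.comp hV.ennreal_toReal).aestronglyMeasurable, ?_⟩
  -- The two moments dominate the logarithm, since `1 - r⁻¹ ≤ log r ≤ r ^ a / a`.
  have hbound : ∫⁻ ω, (ENNReal.ofReal a⁻¹ * V ω ^ a + (V ω)⁻¹) ∂P < ∞ := by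
    have hVi : Measurable fun ω => (V ω)⁻¹ := hV.inv
    rw [lintegral_add_right _ hVi, lintegral_const_mul _ (hV.pow_const a)]
    exact ENNReal.add_lt_top.2 ⟨ENNReal.mul_lt_top ENNReal.ofReal_lt_top hpow, hinv⟩
  refine (lintegral_mono_ae ?_).trans_lt hbound
  filter_upwards [hVae] with ω hω
  obtain ⟨r, hr0, hr⟩ : ∃ r : ℝ, 0 < r ∧ V ω = ENNReal.ofReal r :=
    ⟨(V ω).toReal, ENNReal.toReal_pos hω.1 hω.2, (ENNReal.ofReal_toReal hω.2).symm⟩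
  rw [hr, ENNReal.toReal_ofReal hr0.le, ENNReal.ofReal_rpow_of_pos hr0,
    ← ENNReal.ofReal_inv_of_pos hr0, ← ENNReal.ofReal_mul (by positivity),
    ← ENNReal.ofReal_add (by positivity) (by positivity), Real.enorm_eq_ofReal_abs]
  refine ENNReal.ofReal_le_ofReal (abs_le.2 ⟨?_, ?_⟩)
  · have h1 := Real.one_sub_inv_le_log_of_pos hr0
    have h2 : 0 ≤ a⁻¹ * r ^ a := by positivity
    linarith
  · have h1 := Real.log_le_rpow_div hr0.le ha
    have h2 : 0 < r⁻¹ := by positivity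
    rw [div_eq_inv_mul] at h1
    linarith

end StableLaw

/-! ### The total mass of the cascade and telescoping of the increments -/

section TotalMass

variable {𝒳 : ℕ → Type*} [∀ l, MeasurableSpace (𝒳 l)] {k : ℕ} {m : Fin k → ℝ}
  {ν : (l : Fin k) → Kernel (Prefix 𝒳 l) (𝒳 l)} [∀ l, IsMarkovKernel (ν l)]
  {X : Prefix 𝒳 k → ℝ} {Ω : Type*} [MeasurableSpace Ω] {P : Measure Ω} [IsProbabilityMeasure P]
  {u : (l : Fin k) → (Fin (l + 1) → ℕ) → Ω → ℝ} {z : (l : Fin k) → (Fin (l + 1) → ℕ) → Ω → 𝒳 l}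

/-- Starting from the identity function (`C = b = 1`) at the leaves, each generation replaces the
exponent by its own parameter. The clause `m j < b` for the remaining generations keeps the next
constant finite: it starts from `m j < 1` and is renewed by strict monotonicity. -/
lemma laplace_power (hm : StrictMono m) (hm0 : ∀ l, 0 < m l) (hm1 : ∀ l, m l < 1)
    (hu : IsPoissonCascade m u P) (hz : IsMarkProcess (fun l x => ν l x) z P)
    (huz : MarksIndep u z P) {l : ℕ} (hl : l ≤ k) :
    ∃ (C : ℝ≥0∞) (b : ℝ), C ≠ 0 ∧ C ≠ ∞ ∧ 0 < b ∧ b ≤ 1 ∧ (∀ j : Fin k, (j : ℕ) < l → m j < b) ∧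
      ∀ t : ℝ, 0 < t →
        laplace u z P le_rfl (fun p => ENNReal.ofReal (t * ∏ i, p.1 i)) =
          laplace u z P hl (fun p => C * ENNReal.ofReal (t * ∏ i, p.1 i) ^ b) := by
  refine Nat.decreasingInduction (motive := fun n hn => ∃ (C : ℝ≥0∞) (b : ℝ), C ≠ 0 ∧ C ≠ ∞ ∧
      0 < b ∧ b ≤ 1 ∧ (∀ j : Fin k, (j : ℕ) < n → m j < b) ∧ ∀ t : ℝ, 0 < t →
        laplace u z P le_rfl (fun p => ENNReal.ofReal (t * ∏ i, p.1 i)) =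
          laplace u z P hn (fun p => C * ENNReal.ofReal (t * ∏ i, p.1 i) ^ b)) ?_ ?_ hl
  · rintro n hn ⟨C, b, hC0, hC, hb, hb1, hmb, h⟩
    refine ⟨powerConst C b (m ⟨n, hn⟩), m ⟨n, hn⟩, powerConst_ne_zero hC0 _ _,
      powerConst_ne_top hC (hm0 _) (hmb ⟨n, hn⟩ (Nat.lt_succ_self n)), hm0 _, (hm1 _).le,
      fun j hj => hm hj, fun t ht => (h t ht).trans ?_⟩
    have hh : Measurable fun s : ℝ => C * ENNReal.ofReal (t * s) ^ b :=
      ((ENNReal.measurable_ofReal.comp (measurable_id.const_mul t)).pow_const b).const_mul C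
    refine (laplace_prod_succ hu hz huz ⟨n, hn⟩ hh).trans ?_
    congr 1
    funext p
    exact radialStep_power hb (hm0 _) ht _
  · refine ⟨1, 1, one_ne_zero, ENNReal.one_ne_top, one_pos, le_rfl, fun j _ => hm1 j,
      fun t _ => ?_⟩
    simp

lemma lintegral_expNeg_totalMass (hm : StrictMono m) (hm0 : ∀ l, 0 < m l) (hm1 : ∀ l, m l < 1)
    (hu : IsPoissonCascade m u P) (hz : IsMarkProcess (fun l x => ν l x) z P)
    (huz : MarksIndep u z P) :
    ∃ (C : ℝ≥0∞) (b : ℝ), C ≠ 0 ∧ C ≠ ∞ ∧ 0 < b ∧ b ≤ 1 ∧ ∀ t : ℝ, 0 < t →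
      ∫⁻ ω, expNeg (ENNReal.ofReal t * ∑' α : Fin k → ℕ, ENNReal.ofReal (leafWeight u α ω)) ∂P =
        expNeg (C * ENNReal.ofReal t ^ b) := by
  obtain ⟨C, b, hC0, hC, hb, hb1, -, h⟩ := laplace_power hm hm0 hm1 hu hz huz (Nat.zero_le k)
  refine ⟨C, b, hC0, hC, hb, hb1, fun t ht => ?_⟩
  have h1 := h t ht
  rw [laplace_zero] at h1
  simp only [Finset.univ_eq_empty, Finset.prod_empty, mul_one] at h1
  rw [← h1]
  refine lintegral_congr fun ω => ?_
  rw [← ENNReal.tsum_mul_left]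
  congr 1
  refine tsum_congr fun α => ?_
  rw [← ENNReal.ofReal_mul ht.le]
  rfl

lemma measurable_leafWeight (hu : ∀ l a, Measurable (u l a)) (α : Fin k → ℕ) :
    Measurable (leafWeight u α) :=
  Finset.measurable_prod _ fun _ _ => hu _ _

lemma ae_leafWeight_pos (hu : IsPoissonCascade m u P) :
    ∀ᵐ ω ∂P, ∀ α : Fin k → ℕ, 0 < leafWeight u α ω := by
  have h : ∀ᵐ ω ∂P, ∀ (l : Fin k) (p : Fin l → ℕ) (n : ℕ),
      0 < u l (Fin.snoc (α := fun _ => ℕ) p n) ω :=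
    ae_all_iff.2 fun l => ae_all_iff.2 fun p => (hu.poisson l p).ae_pos fun n => hu.measurable _ _
  filter_upwards [h] with ω hω α
  refine Finset.prod_pos fun l _ => ?_
  rw [ancestorPoint, ← Fin.snoc_init_self (α := fun _ => ℕ)
    (Fin.take (l + 1) (Nat.succ_le_of_lt l.isLt) α)]
  exact hω _ _ _

omit [∀ l, IsMarkovKernel (ν l)] [MeasurableSpace Ω] in
lemma increment_eq_pathRatio (α : Fin k → ℕ) (l : Fin k) (ω : Ω) :
    increment m ν X z α l ω = pathRatio m ν X le_rfl (pathMarks z le_rfl α ω) l := by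
  rw [increment, pathMarks_succ z l]
  rfl

omit [∀ l, IsMarkovKernel (ν l)] in
-- The exponents telescope along the path from the root.
lemma prod_pathRatio {l : ℕ} (hl : l ≤ k) (x : Prefix 𝒳 l) :
    ∏ i, pathRatio m ν X hl x i = Real.exp (levelFun m ν X hl x - rootValue m ν X) := by
  induction l with
  | zero =>
    have : x = fun i => i.elim0 := Subsingleton.elim _ _
    simp [rootValue, this]
  | succ n ih =>
    obtain ⟨y, t, rfl⟩ : ∃ (y : Prefix 𝒳 n) (t : 𝒳 n), x = extend y t :=
      ⟨Fin.init x, x (Fin.last n), (Fin.snoc_init_self x).symm⟩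
    rw [Fin.prod_univ_castSucc]
    have h1 : ∀ i : Fin n, pathRatio m ν X hl (extend y t) i.castSucc =
        pathRatio m ν X (Nat.le_of_succ_le hl) y i := fun i => pathRatio_castSucc ⟨n, hl⟩ y t i
    have h2 : pathRatio m ν X hl (extend y t) (Fin.last n) = ratio m ν X ⟨n, hl⟩ y t :=
      pathRatio_last ⟨n, hl⟩ y t
    simp_rw [h1]
    rw [h2, ih, ratio, ← Real.exp_add]
    congr 1
    ring

end TotalMass

/-! ### The invariance of the cascade -/

section Invariance

variable {𝒳 : ℕ → Type*} [∀ l, MeasurableSpace (𝒳 l)] {k : ℕ} {m : Fin k → ℝ}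
  {ν : (l : Fin k) → Kernel (Prefix 𝒳 l) (𝒳 l)} [∀ l, IsMarkovKernel (ν l)]
  {X : Prefix 𝒳 k → ℝ} {Ω Ω' : Type*} [MeasurableSpace Ω] [MeasurableSpace Ω']
  {P : Measure Ω} [IsProbabilityMeasure P] {P' : Measure Ω'} [IsProbabilityMeasure P']
  {u : (l : Fin k) → (Fin (l + 1) → ℕ) → Ω → ℝ} {z : (l : Fin k) → (Fin (l + 1) → ℕ) → Ω → 𝒳 l}
  {u' : (l : Fin k) → (Fin (l + 1) → ℕ) → Ω' → ℝ}
  {z' : (l : Fin k) → (Fin (l + 1) → ℕ) → Ω' → 𝒳 l}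

omit [∀ l, IsMarkovKernel (ν l)] [MeasurableSpace Ω] in
lemma ancestorPoint_mul_increment (α : Fin k → ℕ) (ω : Ω) :
    (fun l => ancestorPoint u α l ω * increment m ν X z α l ω) =
      rescale m ν X le_rfl (pathPoints u le_rfl α ω, pathMarks z le_rfl α ω) := by
  funext l
  rw [increment_eq_pathRatio]
  rfl

omit [∀ l, IsMarkovKernel (ν l)] [MeasurableSpace Ω] in
lemma leafWeight_mul_exp (α : Fin k → ℕ) (ω : Ω) :
    leafWeight u α ω * Real.exp (X (pathMarks z le_rfl α ω) - rootValue m ν X) =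
      ∏ i, rescale m ν X le_rfl (pathPoints u le_rfl α ω, pathMarks z le_rfl α ω) i := by
  have h := prod_pathRatio (m := m) (ν := ν) (X := X) le_rfl (pathMarks z le_rfl α ω)
  rw [levelFun_self] at h
  rw [← h]
  simp only [rescale, Finset.prod_mul_distrib]
  rfl

/-- The cascade with points multiplied by the increments has the law of the cascade with reweighted
marks. -/
lemma identDistrib_rescaled_cascade (hX : Measurable X) (hu : IsPoissonCascade m u P)
    (hz : IsMarkProcess (fun l x => ν l x) z P) (huz : MarksIndep u z P)
    (hu' : IsPoissonCascade m u' P') (hz' : IsMarkProcess (reweighted m ν X) z' P')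
    (huz' : MarksIndep u' z' P') :
    IdentDistrib
      (pointProcess fun (α : Fin k → ℕ) ω =>
        ((fun l => ancestorPoint u α l ω * increment m ν X z α l ω : Fin k → ℝ),
          pathMarks z le_rfl α ω))
      (pointProcess fun (α : Fin k → ℕ) ω' =>
        ((fun l => ancestorPoint u' α l ω' : Fin k → ℝ), pathMarks z' le_rfl α ω')) P P' := by
  have hp : ∀ α : Fin k → ℕ, Measurable fun ω =>
      (pathPoints u le_rfl α ω, pathMarks z le_rfl α ω) := fun α =>
    (measurable_pathMarks (𝒳 := fun _ => ℝ) hu.measurable le_rfl α).prodMk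
      (measurable_pathMarks hz.measurable le_rfl α)
  simp_rw [ancestorPoint_mul_increment]
  refine identDistrib_pointProcess (fun α => ?_) (fun α => ?_) fun f hf => ?_
  · exact ((measurable_rescale m ν hX le_rfl).comp (hp α)).prodMk
      (measurable_pathMarks hz.measurable le_rfl α)
  · exact (measurable_pathMarks (𝒳 := fun _ => ℝ) hu'.measurable le_rfl α).prodMk
      (measurable_pathMarks hz'.measurable le_rfl α)
  · exact laplace_rescale hX hu hz huz hu' hz' huz' le_rfl hf

/-- The leaf weights multiplied by `exp (X - X₀)` have the law of the leaf weights. -/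
lemma identDistrib_leafWeight (hm0 : ∀ l, 0 < m l) (hm1 : ∀ l, m l < 1) (hX : Measurable X)
    (hu : IsPoissonCascade m u P) (hz : IsMarkProcess (fun l x => ν l x) z P)
    (huz : MarksIndep u z P)
    (hexp : ∀ α : Fin k → ℕ, Integrable (fun ω => Real.exp (X (pathMarks z le_rfl α ω))) P) :
    IdentDistrib
      (pointProcess fun (α : Fin k → ℕ) ω =>
        leafWeight u α ω * Real.exp (X (pathMarks z le_rfl α ω) - rootValue m ν X))
      (pointProcess fun (α : Fin k → ℕ) ω => leafWeight u α ω) P P := by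
  refine identDistrib_pointProcess (fun α => ?_) (measurable_leafWeight hu.measurable)
    fun f hf => ?_
  · exact (measurable_leafWeight hu.measurable α).mul (Real.measurable_exp.comp
      ((hX.comp (measurable_pathMarks hz.measurable le_rfl α)).sub_const _))
  · simp_rw [leafWeight_mul_exp]
    exact laplace_prod_rescale hm0 hm1 hX hu hz huz hexp le_rfl hf

/-- The mean of the logarithm of the average of `exp X` with respect to the normalized weights. -/
lemma log_tsum_normalizedWeight (hm : StrictMono m) (hm0 : ∀ l, 0 < m l) (hm1 : ∀ l, m l < 1)
    (hX : Measurable X) (hu : IsPoissonCascade m u P)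
    (hz : IsMarkProcess (fun l x => ν l x) z P) (huz : MarksIndep u z P)
    (hexp : ∀ α : Fin k → ℕ, Integrable (fun ω => Real.exp (X (pathMarks z le_rfl α ω))) P) :
    (∀ᵐ ω ∂P, Summable (fun α : Fin k → ℕ => leafWeight u α ω) ∧
      0 < ∑' α : Fin k → ℕ, leafWeight u α ω ∧
      Summable fun α : Fin k → ℕ => normalizedWeight u α ω *
        Real.exp (X (pathMarks z le_rfl α ω))) ∧
    Integrable (fun ω => Real.log (∑' α : Fin k → ℕ, normalizedWeight u α ω *
      Real.exp (X (pathMarks z le_rfl α ω)))) P ∧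
    ∫ ω, Real.log (∑' α : Fin k → ℕ, normalizedWeight u α ω *
      Real.exp (X (pathMarks z le_rfl α ω))) ∂P = rootValue m ν X := by
  set x₀ := rootValue m ν X
  set V : Ω → ℝ≥0∞ := fun ω => ∑' α : Fin k → ℕ, ENNReal.ofReal (leafWeight u α ω) with hV
  set V' : Ω → ℝ≥0∞ := fun ω => ∑' α : Fin k → ℕ, ENNReal.ofReal
    (leafWeight u α ω * Real.exp (X (pathMarks z le_rfl α ω) - x₀)) with hV'
  have hVm : Measurable V := Measurable.tsum fun α =>
    (measurable_leafWeight hu.measurable α).ennreal_ofReal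
  -- The total mass is the integral of `ENNReal.ofReal` against the counting measure, a measurable
  -- functional of it, so equality in law of the point processes transfers.
  have hid : IdentDistrib V' V P P := by
    have h := (identDistrib_leafWeight hm0 hm1 hX hu hz huz hexp).comp
      (Measure.measurable_lintegral (f := ENNReal.ofReal) ENNReal.measurable_ofReal)
    convert h using 1
    · funext ω
      exact (lintegral_pointProcess (fun (α : Fin k → ℕ) ω => leafWeight u α ω *
        Real.exp (X (pathMarks z le_rfl α ω) - x₀)) ω ENNReal.measurable_ofReal).symm
    · funext ω
      exact (lintegral_pointProcess (fun (α : Fin k → ℕ) ω => leafWeight u α ω) ω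
        ENNReal.measurable_ofReal).symm
  obtain ⟨C, b, hC0, hC, hb, hb1, hL⟩ := lintegral_expNeg_totalMass hm hm0 hm1 hu hz huz
  obtain ⟨hVae, hVlog⟩ := log_integrable_of_laplace hVm hC0 hC hb hb1 hL
  have hV'ae : ∀ᵐ ω ∂P, V' ω ≠ 0 ∧ V' ω ≠ ∞ :=
    hid.symm.ae_snd (p := fun v : ℝ≥0∞ => v ≠ 0 ∧ v ≠ ∞)
      ((measurableSet_singleton 0).compl.inter (measurableSet_singleton ∞).compl) hVae
  have hlogid := hid.comp (Real.measurable_log.comp ENNReal.measurable_toReal)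
  have hV'log : Integrable (fun ω => Real.log (V' ω).toReal) P := hlogid.integrable_iff.2 hVlog
  have hpos := ae_leafWeight_pos hu
  have hsum : ∀ᵐ ω ∂P, Summable (fun α : Fin k → ℕ => leafWeight u α ω) ∧
      0 < ∑' α : Fin k → ℕ, leafWeight u α ω ∧
      (Summable fun α : Fin k → ℕ => normalizedWeight u α ω *
        Real.exp (X (pathMarks z le_rfl α ω))) ∧
      Real.log (∑' α : Fin k → ℕ, normalizedWeight u α ω *
        Real.exp (X (pathMarks z le_rfl α ω))) =
          Real.log (V' ω).toReal - Real.log (V ω).toReal + x₀ := by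
    filter_upwards [hVae, hV'ae, hpos] with ω h1 h2 h3
    have e1 : ∀ α : Fin k → ℕ, (ENNReal.ofReal (leafWeight u α ω)).toReal = leafWeight u α ω :=
      fun α => ENNReal.toReal_ofReal (h3 α).le
    have e2 : ∀ α : Fin k → ℕ, (ENNReal.ofReal (leafWeight u α ω *
        Real.exp (X (pathMarks z le_rfl α ω) - x₀))).toReal =
          leafWeight u α ω * Real.exp (X (pathMarks z le_rfl α ω) - x₀) :=
      fun α => ENNReal.toReal_ofReal (mul_pos (h3 α) (Real.exp_pos _)).le
    have s1 := ENNReal.hasSum_toReal h1.2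
    have s2 := ENNReal.hasSum_toReal h2.2
    simp_rw [e1] at s1
    simp_rw [e2] at s2
    have t1 : (V ω).toReal = ∑' α : Fin k → ℕ, leafWeight u α ω := by
      rw [hV, ENNReal.tsum_toReal_eq fun _ => ENNReal.ofReal_ne_top]
      simp_rw [e1]
    have t2 : (V' ω).toReal = ∑' α : Fin k → ℕ,
        leafWeight u α ω * Real.exp (X (pathMarks z le_rfl α ω) - x₀) := by
      rw [hV', ENNReal.tsum_toReal_eq fun _ => ENNReal.ofReal_ne_top]
      simp_rw [e2]
    have p1 : 0 < (V ω).toReal := ENNReal.toReal_pos h1.1 h1.2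
    have p2 : 0 < (V' ω).toReal := ENNReal.toReal_pos h2.1 h2.2
    -- Pulling out `exp x₀ / V` leaves the summands of `V'`; this yields both summability and the
    -- splitting of the logarithm.
    have e3 : ∀ α : Fin k → ℕ, normalizedWeight u α ω * Real.exp (X (pathMarks z le_rfl α ω)) =
        (Real.exp x₀ / (V ω).toReal) *
          (leafWeight u α ω * Real.exp (X (pathMarks z le_rfl α ω) - x₀)) := fun α => by
      rw [normalizedWeight, ← t1, Real.exp_sub]
      field_simp
    refine ⟨s1.summable, t1 ▸ p1, ?_, ?_⟩
    · simp_rw [e3]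
      exact s2.summable.mul_left _
    · simp_rw [e3]
      rw [tsum_mul_left, ← t2, Real.log_mul (by positivity) p2.ne',
        Real.log_div (Real.exp_pos _).ne' p1.ne', Real.log_exp]
      ring
  have hlog : (fun ω => Real.log (∑' α : Fin k → ℕ, normalizedWeight u α ω *
      Real.exp (X (pathMarks z le_rfl α ω)))) =ᵐ[P]
        fun ω => Real.log (V' ω).toReal - Real.log (V ω).toReal + x₀ := by
    filter_upwards [hsum] with ω h using h.2.2.2
  refine ⟨?_, ?_, ?_⟩
  · filter_upwards [hsum] with ω h using ⟨h.1, h.2.1, h.2.2.1⟩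
  · exact ((hV'log.sub hVlog).add (integrable_const x₀)).congr hlog.symm
  -- The two logarithms are separately integrable with equal means, so they cancel and only `x₀`
  -- remains.
  · have hint : ∫ ω, Real.log (V' ω).toReal ∂P = ∫ ω, Real.log (V ω).toReal ∂P :=
      hlogid.integral_eq
    have hsub : Integrable (fun ω => Real.log (V' ω).toReal - Real.log (V ω).toReal) P :=
      hV'log.sub hVlog
    rw [integral_congr_ae hlog, integral_add hsub (integrable_const x₀),
      integral_sub hV'log hVlog, hint]
    simp

end Invariance

end Cascade

theorem mainTheorem4 {k : ℕ} {𝒳 : ℕ → Type*}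
    [∀ l, TopologicalSpace (𝒳 l)] [∀ l, PolishSpace (𝒳 l)]
    [∀ l, MeasurableSpace (𝒳 l)] [∀ l, BorelSpace (𝒳 l)]
    (m : Fin k → ℝ) (hm : StrictMono m) (hm0 : ∀ l, 0 < m l) (hm1 : ∀ l, m l < 1)
    (ν : (l : Fin k) → Kernel (Cascade.Prefix 𝒳 l) (𝒳 l)) [∀ l, IsMarkovKernel (ν l)]
    (X : Cascade.Prefix 𝒳 k → ℝ) (hX : Measurable X)
    {Ω : Type*} [MeasurableSpace Ω] (P : Measure Ω) [IsProbabilityMeasure P]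
    (u : (l : Fin k) → (Fin (l + 1) → ℕ) → Ω → ℝ)
    (z : (l : Fin k) → (Fin (l + 1) → ℕ) → Ω → 𝒳 l)
    (hu : Cascade.IsPoissonCascade m u P)
    (hz : Cascade.IsMarkProcess (fun l x => ν l x) z P)
    (huz : Cascade.MarksIndep u z P)
    (hexp : ∀ α : Fin k → ℕ,
      Integrable (fun ω => Real.exp (X (Cascade.pathMarks z le_rfl α ω))) P) :
    (∀ {Ω' : Type*} [MeasurableSpace Ω'] (P' : Measure Ω') [IsProbabilityMeasure P']
      (u' : (l : Fin k) → (Fin (l + 1) → ℕ) → Ω' → ℝ)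
      (z' : (l : Fin k) → (Fin (l + 1) → ℕ) → Ω' → 𝒳 l),
      Cascade.IsPoissonCascade m u' P' →
      Cascade.IsMarkProcess (Cascade.reweighted m ν X) z' P' →
      Cascade.MarksIndep u' z' P' →
      IdentDistrib
        (Cascade.pointProcess fun (α : Fin k → ℕ) ω =>
          ((fun l => Cascade.ancestorPoint u α l ω * Cascade.increment m ν X z α l ω :
              Fin k → ℝ),
            Cascade.pathMarks z le_rfl α ω))
        (Cascade.pointProcess fun (α : Fin k → ℕ) ω' =>
          ((fun l => Cascade.ancestorPoint u' α l ω' : Fin k → ℝ),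
            Cascade.pathMarks z' le_rfl α ω')) P P') ∧
    IdentDistrib
      (Cascade.pointProcess fun (α : Fin k → ℕ) ω =>
        Cascade.leafWeight u α ω *
          Real.exp (X (Cascade.pathMarks z le_rfl α ω) - Cascade.rootValue m ν X))
      (Cascade.pointProcess fun (α : Fin k → ℕ) ω => Cascade.leafWeight u α ω) P P ∧
    (∀ᵐ ω ∂P, Summable (fun α : Fin k → ℕ => Cascade.leafWeight u α ω) ∧
      0 < ∑' α : Fin k → ℕ, Cascade.leafWeight u α ω ∧
      Summable fun α : Fin k → ℕ => Cascade.normalizedWeight u α ω *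
        Real.exp (X (Cascade.pathMarks z le_rfl α ω))) ∧
    Integrable (fun ω => Real.log (∑' α : Fin k → ℕ, Cascade.normalizedWeight u α ω *
      Real.exp (X (Cascade.pathMarks z le_rfl α ω)))) P ∧
    ∫ ω, Real.log (∑' α : Fin k → ℕ, Cascade.normalizedWeight u α ω *
      Real.exp (X (Cascade.pathMarks z le_rfl α ω))) ∂P = Cascade.rootValue m ν X :=
  ⟨fun _ _ _ _ hu' hz' huz' =>
    Cascade.identDistrib_rescaled_cascade hX hu hz huz hu' hz' huz',
    Cascade.identDistrib_leafWeight hm0 hm1 hX hu hz huz hexp,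
    Cascade.log_tsum_normalizedWeight hm hm0 hm1 hX hu hz huz hexp⟩
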